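/- **Setting.** Let $U\subseteq\mathbb R^d$ be open with coordinates $x^\mu$; let $A,B\in\{0,\dots,d\}$, $\eta=\mathrm{diag}(+,-,\dots,-,+)$, and let $i,j$ take two values, with $\epsilon_{12}=\epsilon^{12}=1$ antisymmetric and $a^i=\epsilon^{ij}a_j$. Fix a constant vector $V$ with $V_AV^A=1$, a real $\Lambda\neq0$ and a real $\sigma$. For oscillators $Y^A_i,Z^A_i$ put $p=Z-Y$, $q=Z+Y$. Functions $f(Z,Y|x)$ are power series in $q$ with coefficients polynomial in $p$, whose coefficients are smooth complex functions on $U$ (for fixed $x$ this contains all polynomials in $Z,Y$ and all regular functions $P(Z,Y)\int d^n\tau\,\rho(\tau)\exp(\phi(\tau)z_iy^i)$). The star product is $$f*g=f\,\exp\Big(-2\,\epsilon_{ij}\eta^{AB}\,\frac{\overleftarrow\partial}{\partial q^A_i}\frac{\overrightarrow\partial}{\partial p^B_j}\Big)\,g ,$$ so that $[Y^A_i,Y^B_j]_*=\epsilon_{ij}\eta^{AB}=-[Z^A_i,Z^B_j]_*$ and $[Y^A_i,Z^B_j]_*=0$. The differentials $dx^\mu,dZ^A_i$ anticommute with each other and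 commute with functions, and $d=dx^\mu\,\partial/\partial x^\mu$. Write $z_i=V_AZ^A_i$, $y_i=V_AY^A_i$, $dz_i=V_AdZ^A_i$, ${\cal K}=\exp(-2z_iy^i)$. The tilde denotes the substitution $v^A_i\mapsto v^A_i-2V^AV_Bv^B_i$ for $v=Z,Y,dZ$. For $W=dx^\mu W_\mu$, $S=dZ^A_iS^i_A$ and a zero-form $B$, consider the system $E_1=\dots=E_5=0$, where $$E_1=dW+W*W,\quad E_2=dB+W*B-B*\widetilde W,\quad E_3=dS+W*S+S*W,\quad E_4=S*B-B*\widetilde S,$$ $$E_5=S*S-F,\qquad F=-\tfrac12\big(\sigma\,dZ^i_AdZ^A_i+4\Lambda^{-1}dz_idz^i\,B*{\cal K}\big),$$ with $dz_idz^i=dZ_{Ai}dZ^i_BV^AV^B$. (Vasiliev's equations are usually printed with $\sigma=1$; $\sigma$ is the sign or normalisation of the constant term.) **Theorem (formal consistency).** The product of star-algebra-valued forms is associative, $d^2=0$, and $dz_idz^idz_j=0$ for each $j$. For arbitrary fields $W,S,B$ (no equation, reality or $sp(2)$ condition imposed), with all products star products: 1. ($x$-sector) the differential of each equation is a combination of the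 equations: * $dE_1=E_1W-WE_1$; * $dE_2=E_1B-B\widetilde E_1-(WE_2+E_2\widetilde W)$; * $dE_3=(E_3W-WE_3)+(E_1S-SE_1)$; * $dE_4=E_3B-B\widetilde E_3-(WE_4+E_4\widetilde W)-(SE_2+E_2\widetilde S)$; * $dE_5=(E_5W-WE_5)+(E_3S-SE_3)+2\Lambda^{-1}dz_idz^i\,E_2{\cal K}$. 2. ($Z$-sector) the graded (twisted) commutator of $S$ with each equation is a combination of the other equations and their differentials: * $SE_1-E_1S=-(dE_3+WE_3-E_3W)$; * $SE_2+E_2\widetilde S=E_3B-B\widetilde E_3-(dE_4+WE_4+E_4\widetilde W)$; * $SE_3-E_3S=-(dE_5+WE_5-E_5W)+2\Lambda^{-1}dz_idz^i\,E_2{\cal K}$; * $SE_4+E_4\widetilde S=E_5B-B\widetilde E_5$; * $SE_5-E_5S=2\Lambda^{-1}dz_idz^i\,E_4{\cal K}$. 3. $S(SS)=(SS)S$, and the right-hand side $F$ of the equation for $S*S$ is compatible with it: $SF-FS=-2\Lambda^{-1}dz_idz^i\,E_4{\cal K}$. Consequently, at every single point $x\in U$: if $E_1,\dots,E_5$ vanish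 at $x$ (as forms in $dx,dZ$ and functions of $Z,Y$), then $dE_1,\dots,dE_5$ vanish at $x$; and if $E_4$ vanishes at $x$, then $S*F=F*S$ at $x$. -/

import Mathlib

open scoped TensorProduct ContDiff

namespace HigherSpin

noncomputable section

/-! ## Index conventions

Ambient indices `A` run over `0, 1, …, d` (`Fin (d + 1)`) and symplectic indices `i` over the two
values `0, 1` (`Fin 2`). A pair `(A, i)` labels an oscillator with upper index `A`, lower index `i`. -/

/-- Labels `(A, i)` of the oscillators `Y^A_i`, `Z^A_i` and of the differentials `dZ^A_i`. -/
abbrev Osc (d : ℕ) : Type := Fin (d + 1) × Fin 2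

/-- The diagonal entries of the metric `η = diag(+,-,…,-,+)` of `o(d-1,2)`; since `η_{AA} = ±1`,
the same numbers are the entries of the inverse metric `η^{AB}`. -/
def eta {d : ℕ} (A : Fin (d + 1)) : ℝ := if A = 0 ∨ A = Fin.last d then 1 else -1

/-- The symplectic form, `ε_{12} = ε^{12} = 1`. Indices are moved by `a^i = ε^{ij} a_j`. -/
def eps : Matrix (Fin 2) (Fin 2) ℝ := !![0, 1; -1, 0]

/-- The longitudinal projections `v_i = V_A v^A_i`. -/
def long {d : ℕ} (V : Fin (d + 1) → ℝ) {M : Type*} [AddCommGroup M] [Module ℝ M]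
    (v : Osc d → M) (i : Fin 2) : M :=
  ∑ A, (eta A * V A) • v (A, i)

/-- The reflection `ṽ^A_i = v^A_i - 2 V^A V_B v^B_i`. -/
def reflect {d : ℕ} (V : Fin (d + 1) → ℝ) {M : Type*} [AddCommGroup M] [Module ℝ M]
    (v : Osc d → M) (a : Osc d) : M :=
  v a - (2 * V a.1) • long V v a.2

/-! ## The star-product algebra

Functions `f(Z, Y)` are written in the normal-ordering variables `p = Z - Y` and `q = Z + Y`, as power
series in `q` whose coefficients are polynomials in `p`. Polynomials in `Z, Y` are of this
kind, and so is every `P(Z,Y) ∫ dτ ρ(τ) exp(φ(τ) z_i y^i)`, because `z_i y^i = p_i q^i / 2`.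
On this space the star product

  `(f * g)(Z, Y) = π^{-2(d+1)} ∫ dS dT exp(-2 S^A_i T^i_A) f(Z + S, Y + S) g(Z - T, Y + T)`

is, after the Gaussian integration,
`f exp(½ ε_{ij} η^{AB} (∂/∂Y^A_i + ∂/∂Z^A_i)^← (∂/∂Y^B_j - ∂/∂Z^B_j)^→) g`, that is
`f exp(-2 ε_{ij} η^{AB} (∂/∂q^A_i)^← (∂/∂p^B_j)^→) g`, a sum which is finite in each degree in `q`.
The coefficient ring `R` is the ring of functions of the space-time point `x`. -/

section Star

variable {d : ℕ} {R : Type} [CommRing R] [Algebra ℝ R]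

/-- Power series in `q` with polynomial coefficients in `p`, with their commutative ring structure. -/
abbrev PowSer (d : ℕ) (R : Type) [CommRing R] : Type :=
  MvPowerSeries (Osc d) (MvPolynomial (Osc d) R)

/-- `∂/∂q^A_i`. -/
def dq (a : Osc d) (f : PowSer d R) : PowSer d R :=
  MvPowerSeries.pderiv (MvPolynomial (Osc d) R) a f

/-- `∂/∂p^A_i`, acting on the coefficients. -/
def dp (a : Osc d) (f : PowSer d R) : PowSer d R :=
  fun m => MvPolynomial.pderiv a (MvPowerSeries.coeff m f)

/-- The `n`-th power of the bidifferential operator `-2 ε_{ij} η^{AB} (∂/∂q^A_i) ⊗ (∂/∂p^B_j)` applied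
to `f ⊗ g`, followed by commutative multiplication. -/
def bidiff : ℕ → PowSer d R → PowSer d R → PowSer d R
  | 0, f, g => f * g
  | n + 1, f, g => ∑ A, ∑ i, ∑ j, (-2 * eps i j * eta A) • bidiff n (dq (A, i) f) (dp (A, j) g)

/-- The star product `∑ₙ bidiff n f g / n!`. -/
def starMul (f g : PowSer d R) : PowSer d R :=
  fun m => ∑ᶠ n : ℕ, (n.factorial : ℝ)⁻¹ • MvPowerSeries.coeff m (bidiff n f g)

lemma dq_add (a : Osc d) (f g : PowSer d R) : dq a (f + g) = dq a f + dq a g := by simp [dq]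

lemma dq_smul (a : Osc d) (c : ℝ) (f : PowSer d R) : dq a (c • f) = c • dq a f := by
  ext m : 1
  change MvPowerSeries.coeff m (dq a (c • f)) = c • MvPowerSeries.coeff m (dq a f)
  simp only [dq, MvPowerSeries.coeff_pderiv]
  exact smul_mul_assoc c (MvPowerSeries.coeff (m + Finsupp.single a 1) f) _

lemma dp_add (a : Osc d) (f g : PowSer d R) : dp a (f + g) = dp a f + dp a g := by
  ext m : 1
  change MvPolynomial.pderiv a (MvPowerSeries.coeff m (f + g)) =
    MvPolynomial.pderiv a (MvPowerSeries.coeff m f) + MvPolynomial.pderiv a (MvPowerSeries.coeff m g)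
  simp

lemma dp_smul (a : Osc d) (c : ℝ) (f : PowSer d R) : dp a (c • f) = c • dp a f := by
  ext m : 1
  change MvPolynomial.pderiv a (c • MvPowerSeries.coeff m f) =
    c • MvPolynomial.pderiv a (MvPowerSeries.coeff m f)
  rw [← algebraMap_smul R c (MvPowerSeries.coeff m f), Derivation.map_smul, algebraMap_smul]

lemma bidiff_add_left (n : ℕ) (f f' g : PowSer d R) :
    bidiff n (f + f') g = bidiff n f g + bidiff n f' g := by
  induction n generalizing f f' g with
  | zero => simp [bidiff, add_mul]
  | succ n ih => simp [bidiff, dq_add, ih, smul_add, Finset.sum_add_distrib]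

lemma bidiff_add_right (n : ℕ) (f g g' : PowSer d R) :
    bidiff n f (g + g') = bidiff n f g + bidiff n f g' := by
  induction n generalizing f g g' with
  | zero => simp [bidiff, mul_add]
  | succ n ih => simp [bidiff, dp_add, ih, smul_add, Finset.sum_add_distrib]

lemma bidiff_smul_left (n : ℕ) (c : ℝ) (f g : PowSer d R) :
    bidiff n (c • f) g = c • bidiff n f g := by
  induction n generalizing f g with
  | zero => simp [bidiff]
  | succ n ih => simp only [bidiff, dq_smul, ih, Finset.smul_sum, smul_comm c]

lemma bidiff_smul_right (n : ℕ) (c : ℝ) (f g : PowSer d R) :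
    bidiff n f (c • g) = c • bidiff n f g := by
  induction n generalizing f g with
  | zero => simp [bidiff]
  | succ n ih => simp only [bidiff, dp_smul, ih, Finset.smul_sum, smul_comm c]

lemma coeff_bidiff_eq_zero (n : ℕ) (f g : PowSer d R) (m : Osc d →₀ ℕ)
    (h : ∀ b ≤ m, ∀ k : Osc d →₀ ℕ, n ≤ k.degree →
      MvPolynomial.coeff k (MvPowerSeries.coeff b g) = 0) :
    MvPowerSeries.coeff m (bidiff n f g) = 0 := by
  classical
  induction n generalizing f g with
  | zero =>
    rw [bidiff, MvPowerSeries.coeff_mul]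
    refine Finset.sum_eq_zero fun x hx => ?_
    have hb : x.2 ≤ m := by
      rw [← Finset.HasAntidiagonal.mem_antidiagonal.1 hx]; exact le_add_self
    have : MvPowerSeries.coeff x.2 g = 0 := by
      ext k
      simpa using h _ hb k (Nat.zero_le _)
    rw [this, mul_zero]
  | succ n ih =>
    simp only [bidiff, map_sum]
    refine Finset.sum_eq_zero fun A _ => Finset.sum_eq_zero fun i _ => Finset.sum_eq_zero fun j _ => ?_
    have h0 : MvPowerSeries.coeff m (bidiff n (dq (A, i) f) (dp (A, j) g)) = 0 := by
      refine ih _ _ fun b hb k hk => ?_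
      change MvPolynomial.coeff k (MvPolynomial.pderiv (A, j) (MvPowerSeries.coeff b g)) = 0
      rw [MvPolynomial.coeff_pderiv, h b hb _ (by simpa using hk), zero_mul]
    change (_ : ℝ) • MvPowerSeries.coeff m (bidiff n (dq (A, i) f) (dp (A, j) g)) = 0
    rw [h0, smul_zero]

lemma starMul_finite (f g : PowSer d R) (m : Osc d →₀ ℕ) : Function.HasFiniteSupport
    fun n : ℕ => (n.factorial : ℝ)⁻¹ • MvPowerSeries.coeff m (bidiff n f g) := by
  classical
  let N := (Finset.Iic m).sup fun b => (MvPowerSeries.coeff b g).totalDegree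
  refine (Set.finite_Iic N).subset fun n hn => ?_
  by_contra hN
  refine hn ?_
  have hN' : N < n := by simpa using hN
  change (n.factorial : ℝ)⁻¹ • MvPowerSeries.coeff m (bidiff n f g) = 0
  rw [coeff_bidiff_eq_zero n f g m, smul_zero]
  intro b hb k hk
  refine MvPolynomial.coeff_eq_zero_of_totalDegree_lt ?_
  have h1 : (MvPowerSeries.coeff b g).totalDegree ≤ N :=
    Finset.le_sup (f := fun b => (MvPowerSeries.coeff b g).totalDegree) (Finset.mem_Iic.2 hb)
  have h2 : k.degree = ∑ i ∈ k.support, k i := rfl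
  omega

end Star

/-- The star-product algebra of functions `f(Z, Y | x)`, with coefficients in a ring `R` of functions
of `x`: the vector space `PowSer d R` with the star product as multiplication. -/
def Symbol (d : ℕ) (R : Type) [CommRing R] : Type := PowSer d R

section Symbol

variable {d : ℕ} {R : Type} [CommRing R] [Algebra ℝ R]

instance : AddCommGroup (Symbol d R) := inferInstanceAs (AddCommGroup (PowSer d R))

instance : Module ℝ (Symbol d R) := inferInstanceAs (Module ℝ (PowSer d R))

instance : One (Symbol d R) := ⟨(1 : PowSer d R)⟩

instance : Mul (Symbol d R) := ⟨fun f g => starMul (d := d) (R := R) f g⟩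

lemma star_add (f g h : PowSer d R) : starMul f (g + h) = starMul f g + starMul f h := by
  funext m
  refine Eq.trans ?_ (finsum_add_distrib (starMul_finite f g m) (starMul_finite f h m))
  exact finsum_congr fun n => by rw [bidiff_add_right, map_add, smul_add]

lemma add_star (f g h : PowSer d R) : starMul (f + g) h = starMul f h + starMul g h := by
  funext m
  refine Eq.trans ?_ (finsum_add_distrib (starMul_finite f h m) (starMul_finite g h m))
  exact finsum_congr fun n => by rw [bidiff_add_left, map_add, smul_add]

lemma star_smul (c : ℝ) (f g : PowSer d R) : starMul f (c • g) = c • starMul f g := by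
  funext m
  refine Eq.trans ?_ (smul_finsum' c (starMul_finite f g m)).symm
  refine finsum_congr fun n => ?_
  rw [bidiff_smul_right, smul_comm c]
  rfl

lemma smul_star (c : ℝ) (f g : PowSer d R) : starMul (c • f) g = c • starMul f g := by
  funext m
  refine Eq.trans ?_ (smul_finsum' c (starMul_finite f g m)).symm
  refine finsum_congr fun n => ?_
  rw [bidiff_smul_left, smul_comm c]
  rfl

lemma zero_star (f : PowSer d R) : starMul 0 f = 0 := by
  simpa using smul_star (0 : ℝ) (0 : PowSer d R) f

lemma star_zero (f : PowSer d R) : starMul f 0 = 0 := by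
  simpa using star_smul (0 : ℝ) f (0 : PowSer d R)

/-- Only bilinearity of the star product is recorded here. -/
instance : NonUnitalNonAssocRing (Symbol d R) where
  left_distrib := star_add (d := d) (R := R)
  right_distrib := add_star (d := d) (R := R)
  zero_mul := zero_star (d := d) (R := R)
  mul_zero := star_zero (d := d) (R := R)

instance : IsScalarTower ℝ (Symbol d R) (Symbol d R) := ⟨smul_star (d := d) (R := R)⟩

instance : SMulCommClass ℝ (Symbol d R) (Symbol d R) :=
  ⟨fun c f g => (star_smul (d := d) (R := R) c f g).symm⟩

/-- The map of symbols induced by an `ℝ`-linear map of the coefficient rings. -/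
def symMap {R' : Type} [CommRing R'] [Algebra ℝ R'] (φ : R →ₗ[ℝ] R') :
    Symbol d R →ₗ[ℝ] Symbol d R' where
  toFun f := show PowSer d R' from
    fun m => AddMonoidAlgebra.map (φ : R →+ R') (MvPowerSeries.coeff m (show PowSer d R from f))
  map_add' f g := funext fun m => AddMonoidAlgebra.map_add _ _ _
  map_smul' c f := funext fun m => by
    change AddMonoidAlgebra.map (φ : R →+ R') (c • MvPowerSeries.coeff m (show PowSer d R from f)) =
      c • AddMonoidAlgebra.map (φ : R →+ R') (MvPowerSeries.coeff m (show PowSer d R from f))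
    ext k
    simp

/-- The coordinates `p = Z - Y`. -/
def pVar (d : ℕ) (R : Type) [CommRing R] (a : Osc d) : PowSer d R :=
  MvPowerSeries.C (MvPolynomial.X a)

/-- The coordinates `q = Z + Y`. -/
def qVar (d : ℕ) (R : Type) [CommRing R] (a : Osc d) : PowSer d R := MvPowerSeries.X a

/-- `Y^A_i = (q - p)/2`. -/
def yVar (d : ℕ) (R : Type) [CommRing R] [Algebra ℝ R] (a : Osc d) : PowSer d R :=
  (1 / 2 : ℝ) • (qVar d R a - pVar d R a)

/-- `Z^A_i = (q + p)/2`. -/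
def zVar (d : ℕ) (R : Type) [CommRing R] [Algebra ℝ R] (a : Osc d) : PowSer d R :=
  (1 / 2 : ℝ) • (qVar d R a + pVar d R a)

/-- The Klein operator `exp(-2 z_i y^i)`, with `z_i = V_A Z^A_i` and `y^i = ε^{ij} V_A Y^A_j`. -/
def klein (V : Fin (d + 1) → ℝ) : Symbol d R :=
  show PowSer d R from PowerSeries.subst
    ((-2 : ℝ) • ∑ i, ∑ j, eps i j • (long V (zVar d R) i * long V (yVar d R) j))
    (PowerSeries.exp ℝ)

/-- `f̃(Z, Y) = f(Z̃, Ỹ)`: both `p` and `q` are reflected. -/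
def twistFun (V : Fin (d + 1) → ℝ) (f : PowSer d R) : PowSer d R :=
  MvPowerSeries.subst (reflect V (qVar d R))
    (MvPowerSeries.map (MvPolynomial.aeval (R := R)
      (reflect V (MvPolynomial.X : Osc d → MvPolynomial (Osc d) R))).toRingHom f)

lemma hasSubst_reflect (V : Fin (d + 1) → ℝ) :
    MvPowerSeries.HasSubst (reflect V (qVar d R)) := by
  refine MvPowerSeries.hasSubst_of_constantCoeff_zero fun a => ?_
  have hs : ∀ (c : ℝ) (f : PowSer d R), MvPowerSeries.constantCoeff (c • f) =
    c • MvPowerSeries.constantCoeff f := fun c f => rfl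
  simp [reflect, long, qVar, hs]

lemma twistFun_add (V : Fin (d + 1) → ℝ) (f g : PowSer d R) :
    twistFun V (f + g) = twistFun V f + twistFun V g := by
  rw [twistFun, map_add, MvPowerSeries.subst_add (hasSubst_reflect V), ← twistFun, ← twistFun]

lemma twistFun_smul (V : Fin (d + 1) → ℝ) (c : ℝ) (f : PowSer d R) :
    twistFun V (c • f) = c • twistFun V f := by
  rw [twistFun, twistFun, ← MvPowerSeries.subst_smul (hasSubst_reflect V)]
  congr 1
  funext m
  exact AlgHom.map_smul_of_tower (MvPolynomial.aeval (R := R)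
    (reflect V (MvPolynomial.X : Osc d → MvPolynomial (Osc d) R))) c (MvPowerSeries.coeff m f)

/-- The automorphism `f ↦ f̃` as an `ℝ`-linear map. -/
def twist (V : Fin (d + 1) → ℝ) : Symbol d R →ₗ[ℝ] Symbol d R where
  toFun := twistFun (d := d) (R := R) V
  map_add' := twistFun_add (d := d) (R := R) V
  map_smul' := twistFun_smul (d := d) (R := R) V

end Symbol

/-! ## Differential forms

The differentials `dx^μ` and `dZ^A_i` generate an exterior algebra and commute with all functions. -/

/-- Labels of the differentials: `μ` for `dx^μ`, and `(A, i)` for `dZ^A_i`. -/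
abbrev Gen (d : ℕ) : Type := Fin d ⊕ Osc d

/-- The exterior algebra generated by the `dx^μ` and the `dZ^A_i`. -/
abbrev Grass (d : ℕ) : Type := ExteriorAlgebra ℝ (Gen d → ℝ)

/-- Differential forms in `dx`, `dZ` with values in the star-product algebra. The product `*` of the
tensor product is exterior multiplication of the differentials and star multiplication of functions. -/
abbrev Form (d : ℕ) (R : Type) [CommRing R] [Algebra ℝ R] : Type := Grass d ⊗[ℝ] Symbol d R

/-- The basis vectors of the span of the differentials. -/
def gen {d : ℕ} (g : Gen d) : Gen d → ℝ := Pi.single g 1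

/-- `dx^μ`. -/
def dx {d : ℕ} (μ : Fin d) : Grass d := ExteriorAlgebra.ι ℝ (gen (Sum.inl μ))

/-- `dZ^A_i`. -/
def dZ {d : ℕ} (a : Osc d) : Grass d := ExteriorAlgebra.ι ℝ (gen (Sum.inr a))

/-- `dz_i = V_A dZ^A_i`. -/
def dz {d : ℕ} (V : Fin (d + 1) → ℝ) (i : Fin 2) : Grass d := long V dZ i

/-- `dz_i dz^i = dZ_{Ai} dZ^i_B V^A V^B`. -/
def dzdz {d : ℕ} (V : Fin (d + 1) → ℝ) : Grass d := ∑ i, ∑ j, eps i j • (dz V i * dz V j)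

/-- `dZ^i_A dZ^A_i`. -/
def dZdZ (d : ℕ) : Grass d := ∑ A, ∑ i, ∑ j, (eta A * eps i j) • (dZ (A, j) * dZ (A, i))

section Forms

variable {d : ℕ} {R : Type} [CommRing R] [Algebra ℝ R]

/-- A form with constant coefficients. -/
def constForm (R : Type) [CommRing R] [Algebra ℝ R] (θ : Grass d) : Form d R :=
  θ ⊗ₜ[ℝ] (1 : Symbol d R)

/-- A zero-form. -/
def zeroForm (f : Symbol d R) : Form d R := (1 : Grass d) ⊗ₜ[ℝ] f

/-- `W = dx^μ W_μ`. -/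
def xOneForm (W : Fin d → Symbol d R) : Form d R := ∑ μ, dx μ ⊗ₜ[ℝ] W μ

/-- `S = dZ^A_i S^i_A`. -/
def zOneForm (S : Osc d → Symbol d R) : Form d R := ∑ a, dZ a ⊗ₜ[ℝ] S a

/-- The linear substitution `dZ ↦ dZ̃`, `dx ↦ dx` on the span of the differentials. -/
def reflectGen (V : Fin (d + 1) → ℝ) : (Gen d → ℝ) →ₗ[ℝ] (Gen d → ℝ) :=
  (Pi.basisFun ℝ (Gen d)).constr ℝ
    (Sum.elim (fun μ => gen (Sum.inl μ)) (reflect V fun a => gen (Sum.inr a)))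

/-- `Φ̃(dx, dZ, Z, Y) = Φ(dx, dZ̃, Z̃, Ỹ)`. -/
def tilde (V : Fin (d + 1) → ℝ) : Form d R →ₗ[ℝ] Form d R :=
  TensorProduct.map (ExteriorAlgebra.map (reflectGen V)).toLinearMap (twist V)

/-- `d = dx^μ ∂_μ`, for given operators `∂_μ` on the coefficients. -/
def extD (D : Fin d → R →ₗ[ℝ] R) : Form d R →ₗ[ℝ] Form d R :=
  ∑ μ, TensorProduct.map (LinearMap.mulLeft ℝ (dx μ)) (symMap (D μ))

end Forms

/-! ## Smooth functions on space-time -/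

section Smooth

variable {d : ℕ}

/-- Extension of a function on `U` by zero. -/
def ext0 (U : TopologicalSpace.Opens (Fin d → ℝ)) (f : U → ℂ) (x : Fin d → ℝ) : ℂ :=
  open Classical in if h : x ∈ U then f ⟨x, h⟩ else 0

variable (U : TopologicalSpace.Opens (Fin d → ℝ))

lemma ext0_of_mem (f : U → ℂ) {x : Fin d → ℝ} (h : x ∈ U) : ext0 U f x = f ⟨x, h⟩ := dif_pos h

/-- Smooth complex-valued functions of `x = (x^0, …, x^{d-1})` in the open set `U`. -/
def SmoothFn : Subalgebra ℝ (U → ℂ) where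
  carrier := {f | ContDiffOn ℝ ∞ (ext0 U f) U}
  mul_mem' {f g} hf hg := (ContDiffOn.mul hf hg).congr fun x hx => by simp [ext0_of_mem U _ hx]
  add_mem' {f g} hf hg := (ContDiffOn.add hf hg).congr fun x hx => by simp [ext0_of_mem U _ hx]
  algebraMap_mem' c := (contDiffOn_const (c := (c : ℂ))).congr fun x hx => by
    simp [ext0_of_mem U _ hx]

/-- The partial derivative `∂_μ` of a smooth function. -/
def partialD (μ : Fin d) : SmoothFn U →ₗ[ℝ] SmoothFn U where
  toFun f := ⟨fun x => fderiv ℝ (ext0 U f) x (Pi.single μ 1), by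
    have h := (f.2 : ContDiffOn ℝ ∞ (ext0 U f) U).fderiv_of_isOpen U.isOpen
      (m := ∞) (by simp)
    exact (h.clm_apply contDiffOn_const).congr fun x hx => ext0_of_mem U _ hx⟩
  map_add' f g := by
    ext x
    have hd : ∀ k : SmoothFn U, DifferentiableAt ℝ (ext0 U k) x := fun k =>
      ((k.2 : ContDiffOn ℝ ∞ (ext0 U k) U).contDiffAt (U.isOpen.mem_nhds x.2)).differentiableAt
        (by simp)
    have h : ext0 U (f + g : SmoothFn U) = ext0 U f + ext0 U g := by
      funext y
      by_cases hy : y ∈ U <;> simp [ext0, hy]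
    change fderiv ℝ (ext0 U (f + g : SmoothFn U)) x (Pi.single μ 1) =
      fderiv ℝ (ext0 U f) x (Pi.single μ 1) + fderiv ℝ (ext0 U g) x (Pi.single μ 1)
    rw [h, fderiv_add (hd f) (hd g)]
    rfl
  map_smul' c f := by
    ext x
    have hd : DifferentiableAt ℝ (ext0 U f) x :=
      ((f.2 : ContDiffOn ℝ ∞ (ext0 U f) U).contDiffAt (U.isOpen.mem_nhds x.2)).differentiableAt
        (by simp)
    have h : ext0 U (c • f : SmoothFn U) = c • ext0 U f := by
      funext y
      by_cases hy : y ∈ U <;> simp [ext0, hy]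
    change fderiv ℝ (ext0 U (c • f : SmoothFn U)) x (Pi.single μ 1) =
      c • fderiv ℝ (ext0 U f) x (Pi.single μ 1)
    rw [h, fderiv_const_smul hd]
    rfl

/-- The value of a smooth function at a point. -/
def evalPt (x : U) : SmoothFn U →ₗ[ℝ] ℂ where
  toFun f := f.1 x
  map_add' _ _ := rfl
  map_smul' _ _ := rfl

/-- The value of a form at the space-time point `x`, with its dependence on `Z, Y, dx, dZ` kept. -/
def valueAt (x : U) : Form d (SmoothFn U) →ₗ[ℝ] Form d ℂ :=
  TensorProduct.map LinearMap.id (symMap (evalPt U x))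

/-- The space-time de Rham differential `d = dx^μ ∂/∂x^μ`. -/
def deRham : Form d (SmoothFn U) →ₗ[ℝ] Form d (SmoothFn U) := extD (partialD U)

end Smooth

/-! ## The nonlinear system -/

/-- A field configuration: the components `W_μ`, `S^i_A` and the function `B` of `(Z, Y | x)`. -/
structure Fields (d : ℕ) (U : TopologicalSpace.Opens (Fin d → ℝ)) where
  /-- The components of the space-time connection. -/
  Wμ : Fin d → Symbol d (SmoothFn U)
  /-- The components of the `Z`-space connection. -/
  SiA : Osc d → Symbol d (SmoothFn U)
  /-- The zero-form. -/
  B0 : Symbol d (SmoothFn U)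

namespace Fields

variable {d : ℕ} {U : TopologicalSpace.Opens (Fin d → ℝ)} (V : Fin (d + 1) → ℝ) (σ Λ : ℝ)
  (Φ : Fields d U)

/-- `W = dx^μ W_μ`. -/
def W : Form d (SmoothFn U) := xOneForm Φ.Wμ

/-- `S = dZ^A_i S^i_A`. -/
def S : Form d (SmoothFn U) := zOneForm Φ.SiA

/-- `B` as a zero-form. -/
def B : Form d (SmoothFn U) := zeroForm Φ.B0

/-- The Klein operator as a zero-form. -/
def K (U : TopologicalSpace.Opens (Fin d → ℝ)) (V : Fin (d + 1) → ℝ) : Form d (SmoothFn U) :=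
  zeroForm (klein V)

/-- `dz_i dz^i` as a form. -/
def dz2 (U : TopologicalSpace.Opens (Fin d → ℝ)) (V : Fin (d + 1) → ℝ) : Form d (SmoothFn U) :=
  constForm (SmoothFn U) (dzdz V)

/-- The right-hand side `-½ (σ dZ^i_A dZ^A_i + 4 Λ⁻¹ dZ_{Ai} dZ^i_B V^A V^B B * K)` of the equation
for `S * S`. -/
def source : Form d (SmoothFn U) :=
  (-(1 / 2) : ℝ) • (σ • constForm (SmoothFn U) (dZdZ d) + (4 * Λ⁻¹) • (dz2 U V * (Φ.B * K U V)))

/-- The left-hand side of `dW + W * W = 0`. -/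
def E1 : Form d (SmoothFn U) := deRham U Φ.W + Φ.W * Φ.W

/-- The left-hand side of `dB + W * B - B * W̃ = 0`. -/
def E2 : Form d (SmoothFn U) := deRham U Φ.B + Φ.W * Φ.B - Φ.B * tilde V Φ.W

/-- The left-hand side of `dS + W * S + S * W = 0`. -/
def E3 : Form d (SmoothFn U) := deRham U Φ.S + Φ.W * Φ.S + Φ.S * Φ.W

/-- The left-hand side of `S * B - B * S̃ = 0`. -/
def E4 : Form d (SmoothFn U) := Φ.S * Φ.B - Φ.B * tilde V Φ.S

/-- The equation `S * S = source`, written as `S * S - source = 0`. -/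
def E5 : Form d (SmoothFn U) := Φ.S * Φ.S - Φ.source V σ Λ

end Fields

end

end HigherSpin

/-! The identities are Bianchi identities. In an associative algebra with a square-zero graded
derivation `δ` and an automorphism `τ` commuting with it, the x-sector formulas follow by expanding
both sides. The first three Z-sector formulas are rearrangements of these. Only the source F needs
more. Its constant term is central and `τ`-invariant. Its other term involves B * K, where the Klein
operator satisfies K * f = f̃ * K, so moving W or B past K produces exactly the twist in the
equations for B. For S there is one discrepancy: K reflects the coefficients of S but not the
differentials dZ. The difference between dZ̃ and dZ is a multiple of dz_j, which the prefactor dz_i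
dz^i kills, because a cubic product of only two anticommuting quantities vanishes. `ConsistencyData`
lists these facts and `ConsistencyData.identities` draws the conclusions.

The analytic content is therefore that the star product on power series in q with coefficients
polynomial in p is associative (`starMul_assoc`), that reflection is an automorphism
(`twistSer_starMul`), that derivations in x act as derivations (`serMap_starMul_of_leibniz`), and
that K implements the reflection (`kleinSer_starMul`).

All of these use one device. By `star_induction` every symbol is a limit of sums of star products of
constants, p and q, where a limit means stabilisation of the coefficients in each q-degree. The maps
involved are continuous in this sense (`FinDet`), and the property to be proved passes to star
products. It remains to check generators, for which the exponential series is explicit: constants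
and p act from the left by ordinary multiplication, and q acts by multiplication plus the derivation
`adq`.

The normal-ordered variables make this work. The left factor is differentiated only in q and the
right factor only in p, and polynomiality in p makes the series finite in each q-degree. -/

namespace HigherSpin

noncomputable section

set_option linter.unusedSectionVars false

/-! ## Agreement of power series up to a given degree in `q` -/

section Agree

variable {d : ℕ} {R R' : Type} [CommRing R] [CommRing R']

/-- The coefficients of all monomials in `q` of degree at most `D` agree. -/
def AgreeTo (D : ℕ) (f g : PowSer d R) : Prop :=
  ∀ m : Osc d →₀ ℕ, m.degree ≤ D → MvPowerSeries.coeff m f = MvPowerSeries.coeff m g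

namespace AgreeTo

variable {D : ℕ} {f f' g g' h : PowSer d R}

lemma refl (D : ℕ) (f : PowSer d R) : AgreeTo D f f := fun _ _ => rfl

lemma symm (h : AgreeTo D f g) : AgreeTo D g f := fun m hm => (h m hm).symm

lemma trans (h₁ : AgreeTo D f g) (h₂ : AgreeTo D g h) : AgreeTo D f h :=
  fun m hm => (h₁ m hm).trans (h₂ m hm)

lemma mono {D' : ℕ} (h : AgreeTo D' f g) (hD : D ≤ D') : AgreeTo D f g :=
  fun m hm => h m (hm.trans hD)

lemma add (h₁ : AgreeTo D f f') (h₂ : AgreeTo D g g') : AgreeTo D (f + g) (f' + g') :=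
  fun m hm => by rw [map_add, map_add, h₁ m hm, h₂ m hm]

lemma smul [Algebra ℝ R] (c : ℝ) (h : AgreeTo D f g) : AgreeTo D (c • f) (c • g) := fun m hm =>
  congrArg (fun x => c • x) (h m hm)

lemma sum {ι : Type*} (s : Finset ι) {F G : ι → PowSer d R} (h : ∀ i ∈ s, AgreeTo D (F i) (G i)) :
    AgreeTo D (∑ i ∈ s, F i) (∑ i ∈ s, G i) := fun m hm => by
  rw [map_sum, map_sum]
  exact Finset.sum_congr rfl fun i hi => h i hi m hm

lemma mul (h₁ : AgreeTo D f f') (h₂ : AgreeTo D g g') : AgreeTo D (f * g) (f' * g') := by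
  classical
  intro m hm
  rw [MvPowerSeries.coeff_mul, MvPowerSeries.coeff_mul]
  refine Finset.sum_congr rfl fun x hx => ?_
  have hx' : x.1.degree + x.2.degree = m.degree := by
    rw [← Finset.HasAntidiagonal.mem_antidiagonal.1 hx, map_add]
  rw [h₁ _ (by omega), h₂ _ (by omega)]

/-- Differentiation in q lowers the q-degree by one, so one degree of agreement is lost.
Differentiation in p acts on coefficients and loses none. -/
lemma dq (a : Osc d) (h : AgreeTo (D + 1) f g) : AgreeTo D (dq a f) (dq a g) := fun m hm => by
  simp only [HigherSpin.dq, MvPowerSeries.coeff_pderiv]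
  rw [h _ (by rw [map_add, Finsupp.degree_single]; omega)]

lemma dp (a : Osc d) (h : AgreeTo D f g) : AgreeTo D (dp a f) (dp a g) := fun m hm =>
  congrArg (MvPolynomial.pderiv a) (h m hm)

end AgreeTo

lemma eq_of_agreeTo {f g : PowSer d R} (h : ∀ D, AgreeTo D f g) : f = g :=
  MvPowerSeries.ext fun m => h m.degree m le_rfl

/-- Continuity for the topology of coefficientwise stabilisation: the coefficients of `T f` up to
any given degree are determined by those of `f` up to some degree. -/
def FinDet (T : PowSer d R → PowSer d R') : Prop :=
  ∀ f D, ∃ D', ∀ f', AgreeTo D' f f' → AgreeTo D (T f) (T f')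

namespace FinDet

variable {R'' : Type} [CommRing R'']

lemma of_agreeTo {T : PowSer d R → PowSer d R'}
    (h : ∀ D f f', AgreeTo D f f' → AgreeTo D (T f) (T f')) : FinDet T :=
  fun f D => ⟨D, fun f' => h D f f'⟩

lemma id : FinDet (fun f : PowSer d R => f) := of_agreeTo fun _ _ _ h => h

lemma comp {S : PowSer d R' → PowSer d R''} {T : PowSer d R → PowSer d R'} (hS : FinDet S)
    (hT : FinDet T) : FinDet fun f => S (T f) := fun f D => by
  obtain ⟨D₁, h₁⟩ := hS (T f) D
  obtain ⟨D₂, h₂⟩ := hT f D₁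
  exact ⟨D₂, fun f' h => h₁ _ (h₂ _ h)⟩

lemma add {S T : PowSer d R → PowSer d R'} (hS : FinDet S) (hT : FinDet T) :
    FinDet fun f => S f + T f := fun f D => by
  obtain ⟨D₁, h₁⟩ := hS f D
  obtain ⟨D₂, h₂⟩ := hT f D
  exact ⟨max D₁ D₂, fun f' h => (h₁ f' (h.mono (le_max_left _ _))).add
    (h₂ f' (h.mono (le_max_right _ _)))⟩

lemma sum {ι : Type*} (s : Finset ι) {T : ι → PowSer d R → PowSer d R'} (h : ∀ i, FinDet (T i)) :
    FinDet fun f => ∑ i ∈ s, T i f := by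
  classical
  induction s using Finset.induction_on with
  | empty => exact of_agreeTo fun D f f' _ => by simpa using AgreeTo.refl _ _
  | insert i s hi ih => simpa only [Finset.sum_insert hi] using (h i).add ih

lemma smul [Algebra ℝ R'] (c : ℝ) {T : PowSer d R → PowSer d R'} (hT : FinDet T) :
    FinDet fun f => c • T f :=
  comp (S := fun f => c • f) (of_agreeTo fun _ _ _ h => h.smul c) hT

lemma dp (a : Osc d) {T : PowSer d R → PowSer d R'} (hT : FinDet T) :
    FinDet fun f => HigherSpin.dp a (T f) :=
  comp (S := HigherSpin.dp a) (of_agreeTo fun _ _ _ h => h.dp a) hT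

/-- Uniqueness of continuous extension. Equality is needed only at the approximants of the given
`f`, which is what the limit case of the induction principles supplies. -/
lemma eq_of_approx {S T : PowSer d R → PowSer d R'} (hS : FinDet S) (hT : FinDet T)
    {f : PowSer d R} (h : ∀ D, ∃ f', S f' = T f' ∧ AgreeTo D f f') : S f = T f := by
  refine eq_of_agreeTo fun D => ?_
  obtain ⟨D₁, h₁⟩ := hS f D
  obtain ⟨D₂, h₂⟩ := hT f D
  obtain ⟨f', he, hf⟩ := h (max D₁ D₂)
  have := h₁ f' (hf.mono (le_max_left _ _))
  rw [he] at this
  exact this.trans (h₂ f' (hf.mono (le_max_right _ _))).symm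

end FinDet

lemma finite_degree_le (D : ℕ) : {m : Osc d →₀ ℕ | m.degree ≤ D}.Finite :=
  Finsupp.finite_of_degree_le D

/-- Sums of monomials are dense. -/
lemma exists_sum_monomial (f : PowSer d R) (D : ℕ) :
    AgreeTo D f (∑ m ∈ (finite_degree_le (d := d) D).toFinset,
      MvPowerSeries.monomial m (MvPowerSeries.coeff m f)) := by
  classical
  intro m hm
  simp [MvPowerSeries.coeff_monomial, hm]

/-- Density of finite sums of monomials. The hypothesis `lim` is later discharged by
`FinDet.eq_of_approx`. -/
lemma monomial_induction {P : PowSer d R → Prop} (zero : P 0) (add : ∀ f g, P f → P g → P (f + g))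
    (monomial : ∀ m c, P (MvPowerSeries.monomial m c))
    (lim : ∀ f, (∀ D, ∃ f', P f' ∧ AgreeTo D f f') → P f) (f : PowSer d R) : P f := by
  classical
  refine lim f fun D => ⟨_, ?_, exists_sum_monomial f D⟩
  exact Finset.sum_induction _ P add zero fun m _ => monomial _ _

lemma monomial_add_single (m : Osc d →₀ ℕ) (a : Osc d) :
    (MvPowerSeries.monomial (m + Finsupp.single a 1) 1 : PowSer d R) =
      qVar d R a * MvPowerSeries.monomial m 1 := by
  rw [qVar, MvPowerSeries.X, MvPowerSeries.monomial_mul_monomial, one_mul, add_comm]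

lemma monomial_eq_C_mul (m : Osc d →₀ ℕ) (c : MvPolynomial (Osc d) R) :
    (MvPowerSeries.monomial m c : PowSer d R) =
      MvPowerSeries.C c * MvPowerSeries.monomial m 1 := by
  rw [← MvPowerSeries.monomial_zero_eq_C_apply, MvPowerSeries.monomial_mul_monomial, mul_one,
    zero_add]

/-- Exponents grow by one unit at a time, so that each step multiplies a monomial by a single
variable q. -/
lemma finsupp_induction {P : (Osc d →₀ ℕ) → Prop} (zero : P 0)
    (single : ∀ m a, P m → P (m + Finsupp.single a 1)) (m : Osc d →₀ ℕ) : P m := by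
  classical
  induction m using Finsupp.induction with
  | zero => exact zero
  | single_add a n f _ _ ih =>
    clear * - ih single
    induction n with
    | zero => simpa using ih
    | succ n ih' =>
      rw [Finsupp.single_add, add_right_comm]
      exact single _ _ ih'

end Agree

/-! ### The derivations in p and q on power series. -/

section Basic

variable {d : ℕ} {R : Type} [CommRing R]

lemma dq_mul (a : Osc d) (f g : PowSer d R) : dq a (f * g) = dq a f * g + f * dq a g := by
  simp only [dq, Derivation.leibniz, smul_eq_mul]; ring

lemma dp_mul (a : Osc d) (f g : PowSer d R) : dp a (f * g) = dp a f * g + f * dp a g := by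
  classical
  ext m : 1
  change MvPolynomial.pderiv a (MvPowerSeries.coeff m (f * g)) = _
  rw [map_add, MvPowerSeries.coeff_mul, MvPowerSeries.coeff_mul, MvPowerSeries.coeff_mul, map_sum,
    ← Finset.sum_add_distrib]
  refine Finset.sum_congr rfl fun x _ => ?_
  rw [MvPolynomial.pderiv_mul]
  rfl

lemma dq_C (a : Osc d) (c : MvPolynomial (Osc d) R) : dq a (MvPowerSeries.C c) = 0 :=
  MvPowerSeries.pderiv_C

lemma dp_C (a : Osc d) (c : MvPolynomial (Osc d) R) :
    dp a (MvPowerSeries.C c) = MvPowerSeries.C (MvPolynomial.pderiv a c) := by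
  classical
  ext m : 1
  change MvPolynomial.pderiv a (MvPowerSeries.coeff m (MvPowerSeries.C c)) = _
  rw [MvPowerSeries.coeff_C, MvPowerSeries.coeff_C]
  split_ifs <;> simp

lemma dq_qVar [DecidableEq (Osc d)] (a b : Osc d) : dq a (qVar d R b) = if b = a then 1 else 0 := by
  rw [dq, qVar, MvPowerSeries.pderiv_X, Pi.single_apply]

lemma dp_monomial (a : Osc d) (m : Osc d →₀ ℕ) (c : MvPolynomial (Osc d) R) :
    dp a (MvPowerSeries.monomial m c : PowSer d R) =
      MvPowerSeries.monomial m (MvPolynomial.pderiv a c) := by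
  classical
  ext n : 1
  change MvPolynomial.pderiv a (MvPowerSeries.coeff n (MvPowerSeries.monomial m c)) = _
  rw [MvPowerSeries.coeff_monomial, MvPowerSeries.coeff_monomial]
  split_ifs <;> simp

lemma dp_qVar (a b : Osc d) : dp a (qVar d R b) = 0 := by
  rw [qVar, MvPowerSeries.X, dp_monomial]; simp

lemma dq_pVar (a b : Osc d) : dq a (pVar d R b) = 0 := dq_C _ _

lemma dp_pVar [DecidableEq (Osc d)] (a b : Osc d) : dp a (pVar d R b) = if b = a then 1 else 0 := by
  rw [pVar, dp_C, MvPolynomial.pderiv_X, Pi.single_apply]; split_ifs <;> simp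

lemma dp_dp_comm (a b : Osc d) (f : PowSer d R) : dp a (dp b f) = dp b (dp a f) := by
  ext m : 1
  change MvPolynomial.pderiv a (MvPolynomial.pderiv b (MvPowerSeries.coeff m f)) =
    MvPolynomial.pderiv b (MvPolynomial.pderiv a (MvPowerSeries.coeff m f))
  -- The commutator of two derivations is a derivation, hence determined by its values on the
  -- variables, where it vanishes.
  have h : ⁅MvPolynomial.pderiv (R := R) a, MvPolynomial.pderiv b⁆ = 0 :=
    MvPolynomial.derivation_ext fun i => by
      classical
      rw [Derivation.commutator_apply, MvPolynomial.pderiv_X, MvPolynomial.pderiv_X, Pi.single_apply,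
        Pi.single_apply]
      split_ifs <;> simp
  have := DFunLike.congr_fun h (MvPowerSeries.coeff m f)
  rwa [Derivation.commutator_apply, Derivation.zero_apply, sub_eq_zero] at this

lemma dp_dq_comm (a b : Osc d) (f : PowSer d R) : dp a (dq b f) = dq b (dp a f) := by
  ext m : 1
  change MvPolynomial.pderiv a (MvPowerSeries.coeff m (dq b f)) = _
  simp only [dq, MvPowerSeries.coeff_pderiv]
  rw [MvPolynomial.pderiv_mul]
  have : MvPolynomial.pderiv a ((m b : MvPolynomial (Osc d) R) + 1) = 0 := by
    simp
  rw [this, mul_zero, add_zero]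
  rfl

end Basic

/-! ## Associativity of the star product -/

section StarLemmas

variable {d : ℕ} {R : Type} [CommRing R] [Algebra ℝ R]

lemma bidiff_succ (n : ℕ) (f g : PowSer d R) : bidiff (n + 1) f g =
    ∑ A, ∑ i, ∑ j, (-2 * eps i j * eta A) • bidiff n (dq (A, i) f) (dp (A, j) g) := rfl

/-- The left factor is differentiated `n` times in q and so must be known to degree `D + n`. The
right factor is differentiated only in p and needs no extra degrees. -/
lemma agreeTo_bidiff {n D : ℕ} {f f' g g' : PowSer d R} (hf : AgreeTo (D + n) f f')
    (hg : AgreeTo D g g') : AgreeTo D (bidiff n f g) (bidiff n f' g') := by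
  induction n generalizing f f' g g' with
  | zero => exact hf.mul hg
  | succ n ih =>
    exact AgreeTo.sum _ fun A _ => AgreeTo.sum _ fun i _ => AgreeTo.sum _ fun j _ =>
      (ih (AgreeTo.dq _ (by simpa [add_assoc] using hf)) (hg.dp _)).smul _

lemma agreeTo_bidiff_right {n D : ℕ} {f g g' : PowSer d R} (hg : AgreeTo D g g') :
    AgreeTo D (bidiff n f g) (bidiff n f g') :=
  agreeTo_bidiff (AgreeTo.refl _ _) hg

/-- The partial sums of the star product. -/
def starSum (N : ℕ) (f g : PowSer d R) : PowSer d R :=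
  ∑ n ∈ Finset.range N, (n.factorial : ℝ)⁻¹ • bidiff n f g

lemma coeff_real_smul (m : Osc d →₀ ℕ) (c : ℝ) (f : PowSer d R) :
    MvPowerSeries.coeff m (c • f) = c • MvPowerSeries.coeff m f := rfl

/-- Up to a given degree the star product is a finite sum, with a length independent of the left
factor. -/
lemma exists_agreeTo_starSum (g : PowSer d R) (D : ℕ) :
    ∃ N₀, ∀ N ≥ N₀, ∀ f, AgreeTo D (starMul f g) (starSum N f g) := by
  classical
  let N₀ := (finite_degree_le (d := d) D).toFinset.sup
    fun b => (MvPowerSeries.coeff b g).totalDegree + 1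
  refine ⟨N₀, fun N hN f m hm => ?_⟩
  rw [starSum, map_sum]
  change ∑ᶠ n : ℕ, (n.factorial : ℝ)⁻¹ • MvPowerSeries.coeff m (bidiff n f g) = _
  refine finsum_eq_finsetSum_of_support_subset _ fun n hn => ?_
  by_contra hnN
  refine hn ?_
  have hnN' : N ≤ n := by simpa using hnN
  change (n.factorial : ℝ)⁻¹ • MvPowerSeries.coeff m (bidiff n f g) = 0
  rw [coeff_bidiff_eq_zero n f g m, smul_zero]
  intro b hb k hk
  refine MvPolynomial.coeff_eq_zero_of_totalDegree_lt ?_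
  have hbD : b.degree ≤ D := (Finsupp.degree_mono hb).trans hm
  have h1 : (MvPowerSeries.coeff b g).totalDegree + 1 ≤ N₀ :=
    Finset.le_sup (f := fun b => (MvPowerSeries.coeff b g).totalDegree + 1)
      (by simpa using hbD)
  have h2 : k.degree = ∑ i ∈ k.support, k i := rfl
  omega

/-- Identities for the star product reduce to identities for partial sums. Since `N` may be chosen
beyond any bound, several star products can be truncated simultaneously. -/
lemma eq_starMul_of_starSum {f g F : PowSer d R} (h : ∀ D N₀, ∃ N ≥ N₀, AgreeTo D (starSum N f g) F) :
    starMul f g = F := by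
  refine eq_of_agreeTo fun D => ?_
  obtain ⟨N₀, hN₀⟩ := exists_agreeTo_starSum g D
  obtain ⟨N, hN, hF⟩ := h D N₀
  exact (hN₀ N hN f).trans hF

/-- The number `N` of relevant terms depends on the right factor and `D` only, so `D + N` degrees of
the left factor suffice. -/
lemma finDet_starMul_left (g : PowSer d R) : FinDet fun f => starMul f g := fun f D => by
  obtain ⟨N, hN⟩ := exists_agreeTo_starSum g D
  refine ⟨D + N, fun f' h => (hN N le_rfl f).trans (AgreeTo.trans ?_ (hN N le_rfl f').symm)⟩
  refine AgreeTo.sum _ fun n hn => (agreeTo_bidiff (h.mono ?_) (AgreeTo.refl _ _)).smul _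
  have := Finset.mem_range.1 hn
  omega

lemma agreeTo_starMul_right {D : ℕ} (f : PowSer d R) {g g' : PowSer d R} (h : AgreeTo D g g') :
    AgreeTo D (starMul f g) (starMul f g') := by
  obtain ⟨N, hN⟩ := exists_agreeTo_starSum g D
  obtain ⟨N', hN'⟩ := exists_agreeTo_starSum g' D
  refine (hN (max N N') (le_max_left _ _) f).trans
    (AgreeTo.trans ?_ (hN' (max N N') (le_max_right _ _) f).symm)
  exact AgreeTo.sum _ fun n _ => (agreeTo_bidiff_right h).smul _

lemma finDet_starMul_right (f : PowSer d R) : FinDet fun g => starMul f g :=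
  FinDet.of_agreeTo fun _ _ _ h => agreeTo_starMul_right f h

/-- A function of p alone on the left is invisible to the q-derivatives. -/
lemma bidiff_C_mul (n : ℕ) (c : MvPolynomial (Osc d) R) (f g : PowSer d R) :
    bidiff n (MvPowerSeries.C c * f) g = MvPowerSeries.C c * bidiff n f g := by
  induction n generalizing f g with
  | zero => simp only [bidiff, mul_assoc]
  | succ n ih =>
    simp only [bidiff_succ, dq_mul, dq_C, zero_mul, zero_add, ih, Finset.mul_sum, mul_smul_comm]

lemma C_mul_starMul (c : MvPolynomial (Osc d) R) (f g : PowSer d R) :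
    starMul (MvPowerSeries.C c * f) g = MvPowerSeries.C c * starMul f g := by
  refine eq_starMul_of_starSum fun D N₀ => ?_
  obtain ⟨N₁, hN₁⟩ := exists_agreeTo_starSum g D
  refine ⟨max N₀ N₁, le_max_left _ _, ?_⟩
  have h : starSum (max N₀ N₁) (MvPowerSeries.C c * f) g =
      MvPowerSeries.C c * starSum (max N₀ N₁) f g := by
    simp only [starSum, bidiff_C_mul, Finset.mul_sum, mul_smul_comm]
  rw [h]
  exact (AgreeTo.refl _ _).mul (hN₁ _ (le_max_right _ _) f).symm

lemma dq_one (a : Osc d) : dq a (1 : PowSer d R) = 0 := by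
  rw [← map_one MvPowerSeries.C, dq_C]

lemma bidiff_zero_left (n : ℕ) (g : PowSer d R) : bidiff n 0 g = 0 := by
  simpa using bidiff_smul_left n 0 0 g

lemma one_starMul (g : PowSer d R) : starMul 1 g = g := by
  -- At least one term is kept, so that the zeroth, the only nonzero one, can be split off.
  refine eq_starMul_of_starSum fun D N₀ => ⟨N₀ + 1, by omega, ?_⟩
  rw [starSum, Finset.sum_range_succ']
  simp [dq_one, bidiff_zero_left, bidiff, AgreeTo.refl]

lemma bidiff_eq_zero_of_dp {f g : PowSer d R} (hg : ∀ a, dp a g = 0) (n : ℕ) :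
    bidiff (n + 1) f g = 0 := by
  have : ∀ n (f : PowSer d R), bidiff n f 0 = 0 := fun n f => by
    simpa using bidiff_smul_right n 0 f 0
  simp [bidiff_succ, hg, this]

lemma starMul_of_dp_eq_zero {f g : PowSer d R} (hg : ∀ a, dp a g = 0) : starMul f g = f * g := by
  refine eq_starMul_of_starSum fun D N₀ => ⟨N₀ + 1, by omega, ?_⟩
  rw [starSum, Finset.sum_range_succ']
  simp only [bidiff_eq_zero_of_dp hg]
  simp [bidiff, AgreeTo.refl]

lemma starMul_one (f : PowSer d R) : starMul f 1 = f := by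
  rw [starMul_of_dp_eq_zero fun a => ?_, mul_one]
  rw [← map_one MvPowerSeries.C, dp_C]; simp

/-- The derivation `[q^A_i, ·]_*`. -/
def adq (a : Osc d) (f : PowSer d R) : PowSer d R :=
  ∑ j, (-2 * eps a.2 j * eta a.1) • dp (a.1, j) f

lemma dp_sum {ι : Type*} (a : Osc d) (s : Finset ι) (F : ι → PowSer d R) :
    dp a (∑ i ∈ s, F i) = ∑ i ∈ s, dp a (F i) :=
  map_sum (AddMonoidHom.mk' (dp a) (dp_add a)) F s

lemma dp_adq_comm (a b : Osc d) (f : PowSer d R) : dp b (adq a f) = adq a (dp b f) := by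
  simp only [adq, dp_sum, dp_smul, dp_dp_comm b]

lemma bidiff_sum_right {ι : Type*} (n : ℕ) (s : Finset ι) (f : PowSer d R) (F : ι → PowSer d R) :
    bidiff n f (∑ i ∈ s, F i) = ∑ i ∈ s, bidiff n f (F i) :=
  map_sum (AddMonoidHom.mk' (bidiff n f) (bidiff_add_right n f)) F s

lemma sum_bidiff_single (n : ℕ) (a : Osc d) (f g : PowSer d R) :
    ∑ A, ∑ i, ∑ j, (-2 * eps i j * eta A) •
      bidiff n ((dq (A, i) (qVar d R a)) * f) (dp (A, j) g) = bidiff n f (adq a g) := by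
  classical
  obtain ⟨A, i⟩ := a
  rw [Finset.sum_eq_single A, Finset.sum_eq_single i]
  · simp only [dq_qVar, if_true, one_mul, adq, bidiff_sum_right, bidiff_smul_right]
  · intro b _ hb
    simp [dq_qVar, hb.symm, bidiff_zero_left]
  · simp
  · intro b _ hb
    simp [dq_qVar, hb.symm, bidiff_zero_left]
  · simp

/-- Each of the `n + 1` q-derivatives may hit the extra linear factor, and then contributes `adq` on
the right. The count `n + 1` turns 1/(n+1)! into 1/n!, so the summed series yields a star product
again. -/
lemma bidiff_qVar_mul (n : ℕ) (a : Osc d) (f g : PowSer d R) :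
    bidiff (n + 1) (qVar d R a * f) g =
      qVar d R a * bidiff (n + 1) f g + (n + 1 : ℝ) • bidiff n f (adq a g) := by
  induction n generalizing f g with
  | zero =>
    rw [bidiff_succ]
    simp only [dq_mul, bidiff_add_left, smul_add, Finset.sum_add_distrib, sum_bidiff_single]
    rw [add_comm, bidiff_succ]
    simp only [bidiff, Finset.mul_sum, mul_assoc, mul_smul_comm, Nat.cast_zero, zero_add, one_smul]
  | succ n ih =>
    rw [bidiff_succ]
    simp only [dq_mul, bidiff_add_left, smul_add, Finset.sum_add_distrib, sum_bidiff_single]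
    have h : ∑ A, ∑ i, ∑ j, (-2 * eps i j * eta A) •
        bidiff (n + 1) (qVar d R a * dq (A, i) f) (dp (A, j) g) =
          qVar d R a * bidiff (n + 2) f g + (n + 1 : ℝ) • bidiff (n + 1) f (adq a g) := by
      rw [bidiff_succ (n + 1), bidiff_succ n f (adq a g)]
      simp only [ih, smul_add, Finset.sum_add_distrib, Finset.mul_sum, mul_smul_comm, dp_adq_comm,
        Finset.smul_sum, smul_comm (n + 1 : ℝ)]
    rw [h]
    push_cast
    module

lemma inv_factorial_succ_smul {M : Type*} [AddCommGroup M] [Module ℝ M] (n : ℕ) (x : M) :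
    ((n + 1).factorial : ℝ)⁻¹ • ((n + 1 : ℝ) • x) = (n.factorial : ℝ)⁻¹ • x := by
  rw [smul_smul, Nat.factorial_succ]
  congr 1
  have : (n.factorial : ℝ) ≠ 0 := by positivity
  push_cast
  field_simp

lemma starSum_qVar_mul (N : ℕ) (a : Osc d) (f g : PowSer d R) :
    starSum (N + 1) (qVar d R a * f) g =
      qVar d R a * starSum (N + 1) f g + starSum N f (adq a g) := by
  simp only [starSum, Finset.sum_range_succ' _ N, bidiff_qVar_mul, smul_add, Finset.sum_add_distrib,
    inv_factorial_succ_smul, mul_add, Finset.mul_sum, mul_smul_comm]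
  simp only [bidiff, mul_assoc]
  abel

lemma qVar_mul_starMul (a : Osc d) (f g : PowSer d R) :
    starMul (qVar d R a * f) g = qVar d R a * starMul f g + starMul f (adq a g) := by
  refine eq_starMul_of_starSum fun D N₀ => ?_
  obtain ⟨N₁, hN₁⟩ := exists_agreeTo_starSum g D
  obtain ⟨N₂, hN₂⟩ := exists_agreeTo_starSum (adq a g) D
  -- The `adq` term has one summand fewer than the other two partial sums, hence the extra unit.
  refine ⟨max N₀ (max N₁ N₂) + 1, by omega, ?_⟩
  rw [starSum_qVar_mul]
  exact ((AgreeTo.refl _ _).mul (hN₁ _ (by omega) f).symm).add (hN₂ _ (by omega) f).symm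

lemma C_starMul (c : MvPolynomial (Osc d) R) (g : PowSer d R) :
    starMul (MvPowerSeries.C c) g = MvPowerSeries.C c * g := by
  simpa [one_starMul] using C_mul_starMul c 1 g

lemma qVar_starMul (a : Osc d) (g : PowSer d R) :
    starMul (qVar d R a) g = qVar d R a * g + adq a g := by
  simpa [one_starMul] using qVar_mul_starMul a 1 g

/-- The bidifferential operator has constant coefficients, so `dp` commutes with it and meets only
the commutative Leibniz rule. Hence `dp`, and with it `adq`, is a derivation of the star product. -/
lemma dp_bidiff (n : ℕ) (a : Osc d) (f g : PowSer d R) :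
    dp a (bidiff n f g) = bidiff n (dp a f) g + bidiff n f (dp a g) := by
  induction n generalizing f g with
  | zero => exact dp_mul a f g
  | succ n ih =>
    simp only [bidiff_succ, dp_sum, dp_smul, ih, smul_add, Finset.sum_add_distrib, dp_dq_comm,
      dp_dp_comm a]

lemma dp_starMul (a : Osc d) (f g : PowSer d R) :
    dp a (starMul f g) = starMul (dp a f) g + starMul f (dp a g) := by
  refine eq_of_agreeTo fun D => ?_
  obtain ⟨N₁, hN₁⟩ := exists_agreeTo_starSum g D
  obtain ⟨N₂, hN₂⟩ := exists_agreeTo_starSum (dp a g) D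
  refine ((hN₁ (max N₁ N₂) (by omega) f).dp a).trans ?_
  refine AgreeTo.trans ?_ ((hN₁ (max N₁ N₂) (by omega) _).add
    (hN₂ (max N₁ N₂) (by omega) _)).symm
  simp only [starSum, dp_sum, dp_smul, dp_bidiff, smul_add, Finset.sum_add_distrib, AgreeTo.refl]

lemma adq_starMul (a : Osc d) (f g : PowSer d R) :
    adq a (starMul f g) = starMul (adq a f) g + starMul f (adq a g) := by
  have hl : ∀ (F : Fin 2 → PowSer d R), starMul (∑ j, F j) g = ∑ j, starMul (F j) g := fun F =>
    map_sum (AddMonoidHom.mk' (fun f => starMul f g) fun f f' => add_star f f' g) F _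
  have hr : ∀ (F : Fin 2 → PowSer d R), starMul f (∑ j, F j) = ∑ j, starMul f (F j) := fun F =>
    map_sum (AddMonoidHom.mk' (starMul f) (star_add f)) F _
  simp only [adq, hl, hr, dp_starMul, smul_add, Finset.sum_add_distrib, smul_star, star_smul]

/-- Every symbol is a limit of sums of star products of the generators. -/
theorem star_induction {P : PowSer d R → Prop} (add : ∀ f g, P f → P g → P (f + g))
    (const : ∀ r : R, P (MvPowerSeries.C (MvPolynomial.C r))) (p : ∀ a, P (pVar d R a))
    (q : ∀ a, P (qVar d R a)) (mul : ∀ f g, P f → P g → P (starMul f g))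
    (lim : ∀ f, (∀ D, ∃ f', P f' ∧ AgreeTo D f f') → P f) (f : PowSer d R) : P f := by
  have hC : ∀ c : MvPolynomial (Osc d) R, P (MvPowerSeries.C c) := fun c => by
    induction c using MvPolynomial.induction_on with
    | C r => exact const r
    | add c c' h h' => rw [map_add]; exact add _ _ h h'
    | mul_X c a h => rw [map_mul, ← C_starMul]; exact mul _ _ h (p a)
  have hq : ∀ m : Osc d →₀ ℕ, P (MvPowerSeries.monomial m 1) := fun m => by
    induction m using finsupp_induction with
    | zero => simpa [MvPowerSeries.monomial_zero_eq_C_apply] using hC 1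
    | single m a ih =>
      -- A monomial in q alone does not involve p, so `adq` kills it and star multiplication by q is
      -- ordinary multiplication.
      have h0 : adq a (MvPowerSeries.monomial m 1 : PowSer d R) = 0 := by
        simp [adq, dp_monomial]
      have := mul _ _ (q a) ih
      rwa [qVar_starMul, h0, add_zero, ← monomial_add_single] at this
  refine monomial_induction (by simpa using hC 0) add (fun m c => ?_) lim f
  rw [monomial_eq_C_mul, ← C_starMul]
  exact mul _ _ (hC c) (hq m)

/-- The left factors that associate with all pairs are closed under sums, star products and limits.
For a constant or p, left star multiplication is ordinary multiplication. For q, associativity is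
precisely the statement that `adq` is a derivation of the star product. -/
theorem starMul_assoc (f g h : PowSer d R) :
    starMul (starMul f g) h = starMul f (starMul g h) := by
  induction f using star_induction generalizing g h with
  | add f f' hf hf' => simp only [add_star, hf, hf']
  | const r => simp only [C_starMul, C_mul_starMul]
  | p a => simp only [pVar, C_starMul, C_mul_starMul]
  | q a => simp only [qVar_starMul, add_star, qVar_mul_starMul, adq_starMul]; abel
  | mul f f' hf hf' => rw [hf, hf, hf', hf]
  | lim f hf =>
    refine FinDet.eq_of_approx (S := fun f => starMul (starMul f g) h)
      (T := fun f => starMul f (starMul g h))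
      ((finDet_starMul_left h).comp (finDet_starMul_left g)) (finDet_starMul_left _) fun D => ?_
    obtain ⟨f', h', hD⟩ := hf D
    exact ⟨f', h' g h, hD⟩

end StarLemmas

/-! ## Maps of coefficient rings -/

section SymMap

variable {d : ℕ} {R R' : Type} [CommRing R] [Algebra ℝ R] [CommRing R'] [Algebra ℝ R']

/-- `symMap` on the underlying power series. -/
def serMap (φ : R →ₗ[ℝ] R') : PowSer d R →ₗ[ℝ] PowSer d R' := symMap φ

lemma coeff_serMap (φ : R →ₗ[ℝ] R') (f : PowSer d R) (m k : Osc d →₀ ℕ) :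
    MvPolynomial.coeff k (MvPowerSeries.coeff m (serMap φ f)) =
      φ (MvPolynomial.coeff k (MvPowerSeries.coeff m f)) := rfl

lemma powSer_ext {f g : PowSer d R} (h : ∀ m k, MvPolynomial.coeff k (MvPowerSeries.coeff m f) =
    MvPolynomial.coeff k (MvPowerSeries.coeff m g)) : f = g :=
  MvPowerSeries.ext fun m => MvPolynomial.ext _ _ (h m)

lemma agreeTo_serMap (φ : R →ₗ[ℝ] R') {D : ℕ} {f f' : PowSer d R} (h : AgreeTo D f f') :
    AgreeTo D (serMap φ f) (serMap φ f') := fun m hm => by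
  ext k
  rw [coeff_serMap, coeff_serMap, h m hm]

lemma finDet_serMap (φ : R →ₗ[ℝ] R') : FinDet (serMap (d := d) φ) :=
  FinDet.of_agreeTo fun _ _ _ h => agreeTo_serMap φ h

lemma serMap_dp (φ : R →ₗ[ℝ] R') (a : Osc d) (f : PowSer d R) :
    serMap φ (dp a f) = dp a (serMap φ f) := by
  refine powSer_ext fun m k => ?_
  change φ (MvPolynomial.coeff k (MvPolynomial.pderiv a (MvPowerSeries.coeff m f))) =
    MvPolynomial.coeff k (MvPolynomial.pderiv a (MvPowerSeries.coeff m (serMap φ f)))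
  rw [MvPolynomial.coeff_pderiv, MvPolynomial.coeff_pderiv, coeff_serMap]
  -- The factor produced by differentiation is a natural number, so the merely additive `φ` commutes
  -- with it when it is written as a multiple.
  have h : ∀ (S : Type) [CommRing S] (x : S), x * ((k a : S) + 1) = (k a + 1) • x := fun S _ x => by
    rw [nsmul_eq_mul, mul_comm]; push_cast; rfl
  rw [h, h, map_nsmul]

lemma serMap_qVar_mul (φ : R →ₗ[ℝ] R') (a : Osc d) (f : PowSer d R) :
    serMap φ (qVar d R a * f) = qVar d R' a * serMap φ f := by
  classical
  refine powSer_ext fun m k => ?_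
  rw [coeff_serMap, qVar, qVar, MvPowerSeries.X, MvPowerSeries.X, MvPowerSeries.coeff_monomial_mul,
    MvPowerSeries.coeff_monomial_mul]
  split_ifs with h
  · rw [one_mul, one_mul, coeff_serMap]
  · simp

lemma serMap_pVar_mul (φ : R →ₗ[ℝ] R') (a : Osc d) (f : PowSer d R) :
    serMap φ (pVar d R a * f) = pVar d R' a * serMap φ f := by
  classical
  refine powSer_ext fun m k => ?_
  rw [coeff_serMap, pVar, pVar, MvPowerSeries.coeff_C_mul, MvPowerSeries.coeff_C_mul,
    MvPolynomial.coeff_X_mul', MvPolynomial.coeff_X_mul']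
  split_ifs with h
  · rw [coeff_serMap]
  · simp

lemma serMap_one (φ : R →ₗ[ℝ] R') :
    serMap φ (1 : PowSer d R) = MvPowerSeries.C (MvPolynomial.C (φ 1)) := by
  classical
  refine powSer_ext fun m k => ?_
  rw [coeff_serMap, MvPowerSeries.coeff_one, MvPowerSeries.coeff_C]
  split_ifs with h
  · rw [MvPolynomial.coeff_one, MvPolynomial.coeff_C]
    split_ifs <;> simp
  · simp

lemma coeff_const_mul (r : R) (f : PowSer d R) (m k : Osc d →₀ ℕ) :
    MvPolynomial.coeff k (MvPowerSeries.coeff m (MvPowerSeries.C (MvPolynomial.C r) * f)) =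
      r * MvPolynomial.coeff k (MvPowerSeries.coeff m f) := by
  rw [MvPowerSeries.coeff_C_mul, MvPolynomial.coeff_C_mul]

lemma serMap_const (φ : R →ₗ[ℝ] R') (r : R) :
    serMap φ (MvPowerSeries.C (MvPolynomial.C r) : PowSer d R) =
      MvPowerSeries.C (MvPolynomial.C (φ r)) := by
  classical
  rw [← mul_one (MvPowerSeries.C (MvPolynomial.C r)), ← mul_one (MvPowerSeries.C (MvPolynomial.C (φ r)))]
  refine powSer_ext fun m k => ?_
  rw [coeff_serMap, coeff_const_mul, coeff_const_mul, MvPowerSeries.coeff_one,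
    MvPowerSeries.coeff_one]
  split_ifs with h
  · rw [MvPolynomial.coeff_one, MvPolynomial.coeff_one]
    split_ifs <;> simp
  · simp

lemma serMap_adq (φ : R →ₗ[ℝ] R') (a : Osc d) (f : PowSer d R) :
    serMap φ (adq a f) = adq a (serMap φ f) := by
  simp only [adq, map_sum, map_smul, serMap_dp]

lemma serMap_qVar_starMul (φ : R →ₗ[ℝ] R') (a : Osc d) (f : PowSer d R) :
    serMap φ (starMul (qVar d R a) f) = starMul (qVar d R' a) (serMap φ f) := by
  rw [qVar_starMul, qVar_starMul, map_add, serMap_qVar_mul, serMap_adq]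

lemma serMap_pVar_starMul (φ : R →ₗ[ℝ] R') (a : Osc d) (f : PowSer d R) :
    serMap φ (starMul (pVar d R a) f) = starMul (pVar d R' a) (serMap φ f) := by
  rw [pVar, pVar, C_starMul, C_starMul]
  exact serMap_pVar_mul φ a f

/-- Keeping the factor `φ 1` serves two uses: it is 1 for a ring homomorphism and 0 for a
derivation. -/
lemma serMap_pVar (φ : R →ₗ[ℝ] R') (a : Osc d) : serMap φ (pVar d R a) =
    MvPowerSeries.C (MvPolynomial.C (φ 1)) * pVar d R' a := by
  rw [← mul_one (pVar d R a), serMap_pVar_mul, serMap_one, mul_comm]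

lemma serMap_qVar (φ : R →ₗ[ℝ] R') (a : Osc d) : serMap φ (qVar d R a) =
    MvPowerSeries.C (MvPolynomial.C (φ 1)) * qVar d R' a := by
  rw [← mul_one (qVar d R a), serMap_qVar_mul, serMap_one, mul_comm]

/-- A homomorphism of coefficient rings induces a homomorphism of star-product algebras. -/
lemma serMap_starMul_of_mul (φ : R →ₗ[ℝ] R') (h1 : φ 1 = 1) (hφ : ∀ r s, φ (r * s) = φ r * φ s)
    (f g : PowSer d R) : serMap φ (starMul f g) = starMul (serMap φ f) (serMap φ g) := by
  induction f using star_induction generalizing g with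
  | add f f' hf hf' => rw [add_star, map_add, hf, hf', map_add, add_star]
  | const r =>
    rw [C_starMul, serMap_const, C_starMul]
    refine powSer_ext fun m k => ?_
    rw [coeff_serMap, coeff_const_mul, coeff_const_mul, coeff_serMap, hφ]
  | p a => rw [serMap_pVar_starMul, serMap_pVar, h1, map_one, map_one, one_mul]
  | q a => rw [serMap_qVar_starMul, serMap_qVar, h1, map_one, map_one, one_mul]
  | mul f f' hf hf' => rw [starMul_assoc, hf, hf', hf, starMul_assoc]
  | lim f hf =>
    refine FinDet.eq_of_approx (S := fun f => serMap φ (starMul f g))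
      (T := fun f => starMul (serMap φ f) (serMap φ g))
      ((finDet_serMap φ).comp (finDet_starMul_left g))
      ((finDet_starMul_left _).comp (finDet_serMap φ)) fun D => ?_
    obtain ⟨f', h', hD⟩ := hf D
    exact ⟨f', h' g, hD⟩

/-- A derivation of the coefficient ring induces a derivation of the star-product algebra. -/
lemma serMap_starMul_of_leibniz (δ : R →ₗ[ℝ] R) (hδ : ∀ r s, δ (r * s) = δ r * s + r * δ s)
    (f g : PowSer d R) :
    serMap δ (starMul f g) = starMul (serMap δ f) g + starMul f (serMap δ g) := by
  have h1 : δ 1 = 0 := by simpa using hδ 1 1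
  induction f using star_induction generalizing g with
  | add f f' hf hf' =>
    rw [add_star, map_add, hf, hf', map_add, add_star, add_star]; abel
  | const r =>
    rw [serMap_const, C_starMul, C_starMul, C_starMul]
    refine powSer_ext fun m k => ?_
    rw [map_add, MvPolynomial.coeff_add, coeff_serMap, coeff_const_mul, coeff_const_mul,
      coeff_const_mul, coeff_serMap, hδ]
  | p a => rw [serMap_pVar_starMul, serMap_pVar, h1, map_zero, map_zero, zero_mul, zero_star, zero_add]
  | q a => rw [serMap_qVar_starMul, serMap_qVar, h1, map_zero, map_zero, zero_mul, zero_star, zero_add]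
  | mul f f' hf hf' =>
    rw [starMul_assoc, hf, hf', hf, add_star, star_add, starMul_assoc, starMul_assoc, starMul_assoc,
      add_assoc]
  | lim f hf =>
    refine FinDet.eq_of_approx (S := fun f => serMap δ (starMul f g))
      (T := fun f => starMul (serMap δ f) g + starMul f (serMap δ g))
      ((finDet_serMap δ).comp (finDet_starMul_left g))
      (((finDet_starMul_left g).comp (finDet_serMap δ)).add (finDet_starMul_left _)) fun D => ?_
    obtain ⟨f', h', hD⟩ := hf D
    exact ⟨f', h' g, hD⟩

end SymMap

/-! ## The reflection automorphism -/

section Twist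

variable {d : ℕ} {R R' : Type} [CommRing R] [Algebra ℝ R] [CommRing R'] [Algebra ℝ R']
variable (V : Fin (d + 1) → ℝ)

/-- `twist` on the underlying power series. -/
def twistSer : PowSer d R →ₗ[ℝ] PowSer d R := twist V

lemma twistSer_apply (f : PowSer d R) : twistSer V f = twistFun V f := rfl

lemma long_map {M N : Type*} [AddCommGroup M] [Module ℝ M] [AddCommGroup N] [Module ℝ N]
    (T : M →ₗ[ℝ] N) (v : Osc d → M) (i : Fin 2) : T (long V v i) = long V (fun a => T (v a)) i := by
  simp only [long, map_sum, map_smul]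

lemma reflect_map {M N : Type*} [AddCommGroup M] [Module ℝ M] [AddCommGroup N] [Module ℝ N]
    (T : M →ₗ[ℝ] N) (v : Osc d → M) (a : Osc d) :
    T (reflect V v a) = reflect V (fun a => T (v a)) a := by
  simp only [reflect, map_sub, map_smul, long_map]

/-- With V of unit norm, the reflection subtracts the longitudinal component twice. -/
lemma long_reflect {M : Type*} [AddCommGroup M] [Module ℝ M] (hV : ∑ A, eta A * V A * V A = 1)
    (v : Osc d → M) (i : Fin 2) : long V (reflect V v) i = -long V v i := by
  have h : long V (reflect V v) i = long V v i - ∑ A, (2 * (eta A * V A * V A)) • long V v i := by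
    simp only [long, reflect, smul_sub, Finset.sum_sub_distrib, smul_smul]
    congr 1
    refine Finset.sum_congr rfl fun A _ => ?_
    congr 1; ring
  rw [h, ← Finset.sum_smul, ← Finset.mul_sum, hV]
  module

lemma twistSer_mul (f g : PowSer d R) : twistSer V (f * g) = twistSer V f * twistSer V g := by
  simp only [twistSer_apply, twistFun, map_mul, MvPowerSeries.subst_mul (hasSubst_reflect V)]

lemma twistSer_C (c : MvPolynomial (Osc d) R) : twistSer V (MvPowerSeries.C c : PowSer d R) =
    MvPowerSeries.C (MvPolynomial.aeval (R := R)
      (reflect V (MvPolynomial.X : Osc d → MvPolynomial (Osc d) R)) c) := by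
  rw [twistSer_apply, twistFun, MvPowerSeries.map_C, MvPowerSeries.subst_C]
  rfl

lemma twistSer_const (r : R) : twistSer V (MvPowerSeries.C (MvPolynomial.C r) : PowSer d R) =
    MvPowerSeries.C (MvPolynomial.C r) := by
  rw [twistSer_C, MvPolynomial.aeval_C]; rfl

lemma twistSer_one : twistSer V (1 : PowSer d R) = 1 := by
  simpa using twistSer_const (d := d) (R := R) V 1

lemma twistSer_qVar (a : Osc d) : twistSer V (qVar d R a) = reflect V (qVar d R) a := by
  rw [twistSer_apply, twistFun, qVar, MvPowerSeries.map_X, MvPowerSeries.subst_X (hasSubst_reflect V)]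

lemma C_real_smul (c : ℝ) (x : MvPolynomial (Osc d) R) :
    (MvPowerSeries.C (c • x) : PowSer d R) = c • MvPowerSeries.C x := by
  classical
  ext m : 1
  rw [coeff_real_smul, MvPowerSeries.coeff_C, MvPowerSeries.coeff_C]
  split_ifs <;> simp

lemma twistSer_pVar (a : Osc d) : twistSer V (pVar d R a) = reflect V (pVar d R) a := by
  rw [pVar, twistSer_C, MvPolynomial.aeval_X]
  let T : MvPolynomial (Osc d) R →ₗ[ℝ] PowSer d R :=
    { toFun := fun x => MvPowerSeries.C x
      map_add' := map_add _
      map_smul' := C_real_smul }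
  exact reflect_map V T _ a

/-- The reflected q have no constant term, so a truncation of the substituted series is determined
by the same truncation of the original. -/
lemma agreeTo_twistSer {D : ℕ} {f f' : PowSer d R} (h : AgreeTo D f f') :
    AgreeTo D (twistSer V f) (twistSer V f') := by
  have hc : ∀ a, MvPowerSeries.constantCoeff (reflect V (qVar d R) a) = 0 := fun a => by
    have hs : ∀ (c : ℝ) (f : PowSer d R), MvPowerSeries.constantCoeff (c • f) =
      c • MvPowerSeries.constantCoeff f := fun c f => rfl
    simp [reflect, long, qVar, hs]
  intro m hm
  have key : ∀ f : PowSer d R, MvPowerSeries.coeff m (twistSer V f) =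
      MvPolynomial.coeff m (MvPowerSeries.truncTotal (D + 1) (twistSer V f)) := fun f => by
    rw [MvPowerSeries.coeff_truncTotal]; omega
  rw [key, key, twistSer_apply, twistSer_apply, twistFun, twistFun,
    MvPowerSeries.truncTotal_subst hc, MvPowerSeries.truncTotal_subst hc]
  congr 4
  ext n : 1
  rw [MvPowerSeries.coeff_truncTotal_eq_ite, MvPowerSeries.coeff_truncTotal_eq_ite]
  split_ifs with hn
  · rw [MvPowerSeries.coeff_map, MvPowerSeries.coeff_map, h n (by omega)]
  · rfl

lemma finDet_twistSer : FinDet (twistSer (R := R) V) :=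
  FinDet.of_agreeTo fun _ _ _ h => agreeTo_twistSer V h

/-- Every symbol is a limit of polynomials in the generators. -/
theorem comm_induction {P : PowSer d R → Prop} (add : ∀ f g, P f → P g → P (f + g))
    (const : ∀ r : R, P (MvPowerSeries.C (MvPolynomial.C r))) (p : ∀ a, P (pVar d R a))
    (q : ∀ a, P (qVar d R a)) (mul : ∀ f g, P f → P g → P (f * g))
    (lim : ∀ f, (∀ D, ∃ f', P f' ∧ AgreeTo D f f') → P f) (f : PowSer d R) : P f := by
  have hC : ∀ c : MvPolynomial (Osc d) R, P (MvPowerSeries.C c) := fun c => by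
    induction c using MvPolynomial.induction_on with
    | C r => exact const r
    | add c c' h h' => rw [map_add]; exact add _ _ h h'
    | mul_X c a h => rw [map_mul]; exact mul _ _ h (p a)
  have hq : ∀ m : Osc d →₀ ℕ, P (MvPowerSeries.monomial m 1) := fun m => by
    induction m using finsupp_induction with
    | zero => simpa [MvPowerSeries.monomial_zero_eq_C_apply] using hC 1
    | single m a ih =>
      rw [monomial_add_single]
      exact mul _ _ (q a) ih
  refine monomial_induction (by simpa using hC 0) add (fun m c => ?_) lim f
  rw [monomial_eq_C_mul]
  exact mul _ _ (hC c) (hq m)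

lemma dp_sub (a : Osc d) (f g : PowSer d R) : dp a (f - g) = dp a f - dp a g :=
  map_sub (AddMonoidHom.mk' (dp a) (dp_add a)) f g

lemma dp_const (a : Osc d) (r : R) : dp a (MvPowerSeries.C (MvPolynomial.C r) : PowSer d R) = 0 := by
  rw [dp_C]; simp

/-- The chain rule for the reflection. -/
lemma dp_twistSer (B : Fin (d + 1)) (j : Fin 2) (f : PowSer d R) :
    dp (B, j) (twistSer V f) =
      twistSer V (dp (B, j) f - (2 * (eta B * V B)) • ∑ A, V A • dp (A, j) f) := by
  classical
  induction f using comm_induction with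
  | add f f' hf hf' =>
    simp only [map_add, dp_add, hf, hf', smul_add, Finset.sum_add_distrib]
    rw [← map_add]; congr 1; abel
  | const r => simp [twistSer_const, dp_const]
  | p a =>
    obtain ⟨A, i⟩ := a
    rw [twistSer_pVar]
    simp only [reflect, long, dp_sub, dp_smul, dp_sum, dp_pVar, Prod.mk.injEq]
    by_cases hij : i = j
    · subst hij
      by_cases hAB : A = B
      · subst hAB
        simp [twistSer_one, smul_smul, mul_comm, mul_left_comm]
      · have hBA : B ≠ A := fun h => hAB h.symm
        simp [hAB, twistSer_one, smul_smul, mul_comm, mul_left_comm]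
    · simp [hij]
  | q a =>
    rw [twistSer_qVar]
    simp [reflect, long, dp_sub, dp_smul, dp_sum, dp_qVar]
  | mul f f' hf hf' =>
    rw [twistSer_mul, dp_mul, hf, hf', ← twistSer_mul, ← twistSer_mul, ← map_add]
    congr 1
    simp only [dp_mul, smul_add, Finset.sum_add_distrib, sub_mul, mul_sub, Finset.sum_mul,
      Finset.mul_sum, smul_mul_assoc, mul_smul_comm]
    abel
  | lim f hf =>
    refine FinDet.eq_of_approx (S := fun f => dp (B, j) (twistSer V f))
      (T := fun f => twistSer V (dp (B, j) f - (2 * (eta B * V B)) • ∑ A, V A • dp (A, j) f))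
      ((finDet_twistSer V).dp _) ((finDet_twistSer V).comp ?_) hf
    -- The closure properties of `FinDet` are stated for sums and scalar multiples, so the
    -- difference is put in that form.
    simp only [sub_eq_add_neg, ← neg_smul]
    exact (FinDet.id.dp _).add ((FinDet.sum _ fun A => (FinDet.id.dp _).smul _).smul _)

lemma eta_mul_self (A : Fin (d + 1)) : eta A * eta A = 1 := by
  unfold eta; split_ifs <;> norm_num

/-- Reflection preserves the metric contraction hidden in `adq`. The chain rule produces a
longitudinal correction, which the reflection of the index cancels once V has unit norm. -/
lemma reflect_adq (hV : ∑ A, eta A * V A * V A = 1) (a : Osc d) (f : PowSer d R) :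
    reflect V (fun b => adq b (twistSer V f)) a = twistSer V (adq a f) := by
  obtain ⟨A, i⟩ := a
  set t : Fin 2 → Fin (d + 1) → PowSer d R := fun j B => twistSer V (dp (B, j) f) with ht
  set G : Fin 2 → PowSer d R := fun j => ∑ B, V B • t j B with hG
  have hdp : ∀ B j, dp (B, j) (twistSer V f) = t j B - (2 * (eta B * V B)) • G j := fun B j => by
    simp only [dp_twistSer, map_sub, map_smul, map_sum, ht, hG]
  -- Two metric factors cancel and the first part gives `G j`. The correction gives twice `G j` by
  -- the norm condition, leaving the opposite sign.
  have hsum : ∀ j, ∑ B, (eta B * V B * eta B) • (t j B - (2 * (eta B * V B)) • G j) = -G j := by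
    intro j
    have : ∀ B, (eta B * V B * eta B) • (t j B - (2 * (eta B * V B)) • G j) =
        V B • t j B - (2 * (eta B * V B * V B)) • G j := fun B => by
      have h1 : eta B * V B * eta B = V B := by rw [mul_right_comm, eta_mul_self, one_mul]
      rw [h1, smul_sub, smul_smul]
      congr 2; ring
    rw [Finset.sum_congr rfl fun B _ => this B, Finset.sum_sub_distrib, ← Finset.sum_smul,
      ← Finset.mul_sum, hV]
    simp only [hG]
    module
  have hlong : long V (fun b => adq b (twistSer V f)) i = ∑ j, (2 * eps i j) • G j := by
    simp only [long, adq, hdp, Finset.smul_sum]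
    rw [Finset.sum_comm]
    refine Finset.sum_congr rfl fun j _ => ?_
    have h2 := congrArg (fun x => (-2 * eps i j) • x) (hsum j)
    simp only [Finset.smul_sum] at h2
    rw [show (2 * eps i j) • G j = (-2 * eps i j) • -G j by module, ← h2]
    refine Finset.sum_congr rfl fun B _ => ?_
    rw [smul_smul, smul_smul]
    congr 1; ring
  have hA := eta_mul_self A
  rw [reflect, hlong]
  simp only [adq, hdp, map_sum, map_smul, Finset.smul_sum]
  rw [← Finset.sum_sub_distrib]
  refine Finset.sum_congr rfl fun j _ => ?_
  have h3 : (-2 * eps i j * eta A) • (2 * (eta A * V A)) • G j = (-4 * eps i j * V A) • G j := by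
    rw [smul_smul]
    congr 1
    linear_combination (-4 * eps i j * V A) * hA
  rw [smul_sub, h3]
  simp only [ht]
  module

lemma reflect_starMul (v : Osc d → PowSer d R) (a : Osc d) (f : PowSer d R) :
    starMul (reflect V v a) f = reflect V (fun b => starMul (v b) f) a :=
  reflect_map V { toFun := fun g => starMul g f
                  map_add' := fun g h => add_star g h f
                  map_smul' := fun c g => smul_star c g f : PowSer d R →ₗ[ℝ] PowSer d R } v a

lemma reflect_mul (v : Osc d → PowSer d R) (a : Osc d) (f : PowSer d R) :
    reflect V v a * f = reflect V (fun b => v b * f) a :=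
  reflect_map V (LinearMap.mulRight ℝ f) v a

lemma reflect_add {M : Type*} [AddCommGroup M] [Module ℝ M] (v w : Osc d → M) (a : Osc d) :
    reflect V (fun b => v b + w b) a = reflect V v a + reflect V w a := by
  simp only [reflect, long, smul_add, Finset.sum_add_distrib]; abel

/-- Commutative multiplication is respected by any substitution. The only condition on generators is
covariance of `adq`, supplied by `reflect_adq`. -/
theorem twistSer_starMul (hV : ∑ A, eta A * V A * V A = 1) (f g : PowSer d R) :
    twistSer V (starMul f g) = starMul (twistSer V f) (twistSer V g) := by
  induction f using star_induction generalizing g with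
  | add f f' hf hf' => rw [add_star, map_add, hf, hf', map_add, add_star]
  | const r => rw [C_starMul, twistSer_mul, twistSer_const, C_starMul]
  | p a =>
    rw [twistSer_pVar, reflect_starMul]
    simp only [pVar, C_starMul]
    rw [twistSer_mul, ← pVar, twistSer_pVar, reflect_mul]
    rfl
  | q a =>
    rw [twistSer_qVar, reflect_starMul]
    simp only [qVar_starMul]
    rw [map_add, twistSer_mul, twistSer_qVar, reflect_mul, reflect_add, reflect_adq V hV]
  | mul f f' hf hf' => rw [starMul_assoc, hf, hf', hf, starMul_assoc]
  | lim f hf =>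
    refine FinDet.eq_of_approx (S := fun f => twistSer V (starMul f g))
      (T := fun f => starMul (twistSer V f) (twistSer V g))
      ((finDet_twistSer V).comp (finDet_starMul_left g))
      ((finDet_starMul_left _).comp (finDet_twistSer V)) fun D => ?_
    obtain ⟨f', h', hD⟩ := hf D
    exact ⟨f', h' g, hD⟩

lemma serMap_twistSer_of_mul (hV : ∑ A, eta A * V A * V A = 1) (φ : R →ₗ[ℝ] R') (h1 : φ 1 = 1)
    (hφ : ∀ r s, φ (r * s) = φ r * φ s) (f : PowSer d R) :
    serMap φ (twistSer V f) = twistSer V (serMap φ f) := by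
  induction f using star_induction with
  | add f f' hf hf' => simp only [map_add, hf, hf']
  | const r => rw [twistSer_const, serMap_const, twistSer_const]
  | p a =>
    simp only [twistSer_pVar, reflect_map, serMap_pVar, h1, map_one, one_mul]
  | q a =>
    simp only [twistSer_qVar, reflect_map, serMap_qVar, h1, map_one, one_mul]
  | mul f f' hf hf' =>
    rw [twistSer_starMul V hV, serMap_starMul_of_mul φ h1 hφ, hf, hf',
      serMap_starMul_of_mul φ h1 hφ, twistSer_starMul V hV]
  | lim f hf =>
    exact FinDet.eq_of_approx ((finDet_serMap φ).comp (finDet_twistSer V))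
      ((finDet_twistSer V).comp (finDet_serMap φ)) hf

lemma serMap_twistSer_of_leibniz (hV : ∑ A, eta A * V A * V A = 1) (δ : R →ₗ[ℝ] R)
    (hδ : ∀ r s, δ (r * s) = δ r * s + r * δ s) (f : PowSer d R) :
    serMap δ (twistSer V f) = twistSer V (serMap δ f) := by
  have h1 : δ 1 = 0 := by simpa using hδ 1 1
  have hr : ∀ a, reflect V (fun _ => (0 : PowSer d R)) a = 0 := fun a => by simp [reflect, long]
  induction f using star_induction with
  | add f f' hf hf' => simp only [map_add, hf, hf']
  | const r => rw [twistSer_const, serMap_const, twistSer_const]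
  | p a =>
    simp only [twistSer_pVar, reflect_map, serMap_pVar, h1, map_zero, zero_mul, hr]
  | q a =>
    simp only [twistSer_qVar, reflect_map, serMap_qVar, h1, map_zero, zero_mul, hr]
  | mul f f' hf hf' =>
    rw [twistSer_starMul V hV, serMap_starMul_of_leibniz δ hδ, hf, hf',
      serMap_starMul_of_leibniz δ hδ, map_add, twistSer_starMul V hV, twistSer_starMul V hV]
  | lim f hf =>
    exact FinDet.eq_of_approx ((finDet_serMap δ).comp (finDet_twistSer V))
      ((finDet_twistSer V).comp (finDet_serMap δ)) hf

end Twist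

/-! ## The Klein operator -/

section Klein

variable {d : ℕ} {R R' : Type} [CommRing R] [Algebra ℝ R] [CommRing R'] [Algebra ℝ R']
variable (V : Fin (d + 1) → ℝ)

/-- The exponent `-2 z_i y^i` of the Klein operator. -/
def kleinExp (R : Type) [CommRing R] [Algebra ℝ R] : PowSer d R :=
  (-2 : ℝ) • ∑ i, ∑ j, eps i j • (long V (zVar d R) i * long V (yVar d R) j)

/-- The Klein operator as a power series. -/
def kleinSer (R : Type) [CommRing R] [Algebra ℝ R] : PowSer d R := (klein V : Symbol d R)

lemma long_add {M : Type*} [AddCommGroup M] [Module ℝ M] (v w : Osc d → M) (i : Fin 2) :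
    long V (fun b => v b + w b) i = long V v i + long V w i := by
  simp only [long, smul_add, Finset.sum_add_distrib]

lemma long_smul {M : Type*} [AddCommGroup M] [Module ℝ M] (c : ℝ) (v : Osc d → M) (i : Fin 2) :
    long V (fun b => c • v b) i = c • long V v i := by
  simp only [long, Finset.smul_sum, smul_comm c]

/-- Antisymmetry of ε removes the pp and qq terms. The exponent is linear in q, so its powers have
growing q-order and the exponential converges degree by degree. -/
lemma kleinExp_eq : kleinExp V R =
    -(long V (pVar d R) 0 * long V (qVar d R) 1 - long V (pVar d R) 1 * long V (qVar d R) 0) := by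
  have hz : ∀ i, long V (zVar d R) i =
      (1 / 2 : ℝ) • (long V (qVar d R) i + long V (pVar d R) i) := fun i => by
    rw [← long_add, ← long_smul]; rfl
  have hy : ∀ i, long V (yVar d R) i =
      (1 / 2 : ℝ) • (long V (qVar d R) i - long V (pVar d R) i) := fun i => by
    have : yVar d R = fun a => (1 / 2 : ℝ) • (qVar d R a + (-1 : ℝ) • pVar d R a) := by
      funext a; rw [yVar]; module
    rw [this, long_smul, long_add, long_smul]
    module
  simp only [kleinExp, hz, hy, Fin.sum_univ_two, smul_mul_smul_comm]
  simp only [eps, Matrix.of_apply, Matrix.cons_val', Matrix.cons_val_zero, Matrix.cons_val_one,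
    Matrix.cons_val_fin_one, smul_add, smul_smul, mul_sub, add_mul]
  rw [mul_comm (long V (qVar d R) 0) (long V (qVar d R) 1),
    mul_comm (long V (qVar d R) 0) (long V (pVar d R) 1),
    mul_comm (long V (qVar d R) 1) (long V (pVar d R) 0),
    mul_comm (long V (pVar d R) 1) (long V (pVar d R) 0)]
  module

lemma constantCoeff_kleinExp : MvPowerSeries.constantCoeff (kleinExp V R) = 0 := by
  have hq : ∀ i, MvPowerSeries.constantCoeff (long V (qVar d R) i) = 0 := fun i => by
    have hs : ∀ (c : ℝ) (f : PowSer d R), MvPowerSeries.constantCoeff (c • f) =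
      c • MvPowerSeries.constantCoeff f := fun c f => rfl
    simp [long, qVar, hs]
  rw [kleinExp_eq]
  simp [hq]

lemma kleinSer_eq : kleinSer V R = PowerSeries.subst (kleinExp V R) (PowerSeries.exp ℝ) := rfl

/-- Partial sums of the exponential series of the Klein operator. -/
def kleinSum (R : Type) [CommRing R] [Algebra ℝ R] (N : ℕ) : PowSer d R :=
  ∑ n ∈ Finset.range N, (n.factorial : ℝ)⁻¹ • kleinExp V R ^ n

lemma agreeTo_kleinSum {D N : ℕ} (h : D < N) : AgreeTo D (kleinSer V R) (kleinSum V R N) := by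
  intro m hm
  have hs : PowerSeries.HasSubst (kleinExp V R) := by
    rw [PowerSeries.HasSubst, constantCoeff_kleinExp]; exact IsNilpotent.zero
  rw [kleinSer_eq, PowerSeries.coeff_subst hs, kleinSum, map_sum]
  have hc : ∀ n, PowerSeries.coeff n (PowerSeries.exp ℝ) = (n.factorial : ℝ)⁻¹ := fun n => by
    simp [PowerSeries.coeff_exp]
  simp only [hc, coeff_real_smul]
  refine finsum_eq_finsetSum_of_support_subset _ fun n hn => ?_
  by_contra hnN
  refine hn ?_
  have hnN' : N ≤ n := by simpa using hnN
  change (n.factorial : ℝ)⁻¹ • MvPowerSeries.coeff m (kleinExp V R ^ n) = 0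
  rw [MvPowerSeries.coeff_of_lt_order, smul_zero]
  have h1 : (1 : ℕ∞) ≤ (kleinExp V R).order :=
    MvPowerSeries.one_le_order_iff_constCoeff_eq_zero.2 (constantCoeff_kleinExp V)
  have h2 : (n : ℕ∞) ≤ n • (kleinExp V R).order := by
    simpa using nsmul_le_nsmul_right h1 n
  refine lt_of_lt_of_le ?_ (h2.trans (MvPowerSeries.le_order_pow n))
  exact_mod_cast (by omega : m.degree < n)

/-- An operator satisfying the Leibniz rule acts on the Klein operator by its action on the exponent. -/
lemma map_kleinSer_of_leibniz (T : PowSer d R →ₗ[ℝ] PowSer d R)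
    (hT : ∀ f g, T (f * g) = T f * g + f * T g)
    (hD : ∀ D f f', AgreeTo (D + 1) f f' → AgreeTo D (T f) (T f')) :
    T (kleinSer V R) = T (kleinExp V R) * kleinSer V R := by
  have h1 : T 1 = 0 := by simpa using hT 1 1
  have hpow : ∀ n : ℕ, T (kleinExp V R ^ (n + 1)) =
      (n + 1 : ℝ) • (T (kleinExp V R) * kleinExp V R ^ n) := fun n => by
    induction n with
    | zero => simp
    | succ n ih =>
      rw [pow_succ, hT, ih, smul_mul_assoc, mul_assoc, ← pow_succ, mul_comm _ (T _)]
      push_cast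
      module
  -- As for the exponential series, the derivation shifts the summation index and costs one term.
  have hsum : ∀ N, T (kleinSum V R (N + 1)) = T (kleinExp V R) * kleinSum V R N := fun N => by
    rw [kleinSum, kleinSum, Finset.sum_range_succ']
    simp only [map_add, map_sum, map_smul, hpow, inv_factorial_succ_smul, pow_zero, h1, smul_zero,
      add_zero, Finset.mul_sum, mul_smul_comm]
  refine eq_of_agreeTo fun D => ?_
  refine (hD D _ _ (agreeTo_kleinSum V (by omega : D + 1 < D + 1 + 1))).trans ?_
  rw [hsum]
  exact (AgreeTo.refl _ _).mul (agreeTo_kleinSum V (by omega)).symm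

/-- `∂/∂p` as a linear map. -/
def dpLin (a : Osc d) : PowSer d R →ₗ[ℝ] PowSer d R :=
  { toFun := dp a, map_add' := dp_add a, map_smul' := dp_smul a }

lemma dpLin_apply (a : Osc d) (f : PowSer d R) : dpLin a f = dp a f := rfl

/-- `∂/∂q` as a linear map. -/
def dqLin (a : Osc d) : PowSer d R →ₗ[ℝ] PowSer d R :=
  { toFun := dq a, map_add' := dq_add a, map_smul' := dq_smul a }

lemma dqLin_apply (a : Osc d) (f : PowSer d R) : dqLin a f = dq a f := rfl

lemma dp_kleinSer (a : Osc d) : dp a (kleinSer V R) = dp a (kleinExp V R) * kleinSer V R :=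
  map_kleinSer_of_leibniz V (dpLin a) (dp_mul a) fun _ _ _ h => (h.mono (by omega)).dp a

lemma dq_kleinSer (a : Osc d) : dq a (kleinSer V R) = dq a (kleinExp V R) * kleinSer V R :=
  map_kleinSer_of_leibniz V (dqLin a) (dq_mul a) fun _ _ _ h => h.dq a

lemma dp_long_qVar (a : Osc d) (i : Fin 2) : dp a (long V (qVar d R) i) = 0 := by
  simp [long, dp_sum, dp_smul, dp_qVar]

lemma dq_long_pVar (a : Osc d) (i : Fin 2) : dq a (long V (pVar d R) i) = 0 := by
  rw [← dqLin_apply, long_map]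
  simp [dqLin_apply, dq_pVar, long]

lemma dp_long_pVar (A : Fin (d + 1)) (i j : Fin 2) : dp (A, i) (long V (pVar d R) j) =
    if j = i then (eta A * V A) • 1 else 0 := by
  classical
  rw [← dpLin_apply, long_map]
  by_cases h : j = i <;> simp [dpLin_apply, dp_pVar, long, h]

lemma dq_long_qVar (A : Fin (d + 1)) (i j : Fin 2) : dq (A, i) (long V (qVar d R) j) =
    if j = i then (eta A * V A) • 1 else 0 := by
  classical
  rw [← dqLin_apply, long_map]
  by_cases h : j = i <;> simp [dqLin_apply, dq_qVar, long, h]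

lemma dp_kleinExp (A : Fin (d + 1)) (i : Fin 2) : dp (A, i) (kleinExp V R) =
    -((eta A * V A) • ∑ j, eps i j • long V (qVar d R) j) := by
  rw [kleinExp_eq, ← dpLin_apply, map_neg, map_sub, dpLin_apply, dpLin_apply, dp_mul, dp_mul]
  fin_cases i <;> simp [dp_long_qVar, dp_long_pVar, eps]

lemma dq_kleinExp (A : Fin (d + 1)) (i : Fin 2) : dq (A, i) (kleinExp V R) =
    (eta A * V A) • ∑ j, eps i j • long V (pVar d R) j := by
  rw [kleinExp_eq, ← dqLin_apply, map_neg, map_sub, dqLin_apply, dqLin_apply, dq_mul, dq_mul]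
  fin_cases i <;> simp [dq_long_pVar, dq_long_qVar, eps]

/-- The right factor is linear in p, so the series stops after first order. -/
lemma starMul_pVar (f : PowSer d R) (a : Osc d) : starMul f (pVar d R a) =
    f * pVar d R a + ∑ i, (-2 * eps i a.2 * eta a.1) • dq (a.1, i) f := by
  classical
  have hz : ∀ n (f : PowSer d R), bidiff n f 0 = 0 := fun n f => by
    simpa using bidiff_smul_right n 0 f 0
  have hd : ∀ b c, dp b (dp c (pVar d R a)) = 0 := fun b c => by
    rw [dp_pVar]
    split_ifs
    · simpa using dp_const b (1 : R)
    · simpa [dpLin_apply] using map_zero (dpLin (R := R) b)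
  have h1 : bidiff 1 f (pVar d R a) = ∑ i, (-2 * eps i a.2 * eta a.1) • dq (a.1, i) f := by
    obtain ⟨A, j⟩ := a
    rw [bidiff_succ, Finset.sum_eq_single A]
    · refine Finset.sum_congr rfl fun i _ => ?_
      rw [Finset.sum_eq_single j]
      · rw [dp_pVar, if_pos rfl, bidiff, mul_one]
      · intro k _ hk
        rw [dp_pVar, if_neg (by simpa using hk.symm), hz, smul_zero]
      · simp
    · intro B _ hB
      refine Finset.sum_eq_zero fun i _ => Finset.sum_eq_zero fun k _ => ?_
      rw [dp_pVar, if_neg (by simpa using fun h => absurd h.symm hB), hz, smul_zero]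
    · simp
  have h2 : ∀ n, bidiff (n + 1 + 1) f (pVar d R a) = 0 := fun n => by
    rw [bidiff_succ]
    refine Finset.sum_eq_zero fun A _ => Finset.sum_eq_zero fun i _ => Finset.sum_eq_zero fun j _ => ?_
    rw [bidiff_eq_zero_of_dp fun b => hd b _, smul_zero]
  refine eq_starMul_of_starSum fun D N₀ => ⟨N₀ + 2, by omega, ?_⟩
  rw [starSum, Finset.sum_range_succ', Finset.sum_range_succ']
  simp only [h2, zero_add, h1, smul_zero, Finset.sum_const_zero]
  simp only [bidiff, Nat.factorial_zero, Nat.factorial_one, Nat.cast_one, inv_one, one_smul]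
  rw [add_comm]
  exact AgreeTo.refl _ _

lemma twistSer_kleinExp (hV : ∑ A, eta A * V A * V A = 1) :
    twistSer V (kleinExp V R) = kleinExp V R := by
  have hp : ∀ i, twistSer V (long V (pVar d R) i) = -long V (pVar d R) i := fun i => by
    rw [long_map]; simp only [twistSer_pVar]; exact long_reflect V hV _ i
  have hq : ∀ i, twistSer V (long V (qVar d R) i) = -long V (qVar d R) i := fun i => by
    rw [long_map]; simp only [twistSer_qVar]; exact long_reflect V hV _ i
  simp only [kleinExp_eq, map_neg, map_sub, twistSer_mul, hp, hq, neg_mul_neg]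

lemma twistSer_kleinSer (hV : ∑ A, eta A * V A * V A = 1) :
    twistSer V (kleinSer V R) = kleinSer V R := by
  have hpow : ∀ n, twistSer V (kleinExp V R ^ n) = kleinExp V R ^ n := fun n => by
    induction n with
    | zero => simpa using twistSer_one V
    | succ n ih => rw [pow_succ, twistSer_mul, ih, twistSer_kleinExp V hV]
  have hsum : ∀ N, twistSer V (kleinSum V R N) = kleinSum V R N := fun N => by
    simp only [kleinSum, map_sum, map_smul, hpow]
  refine eq_of_agreeTo fun D => ?_
  have h := agreeTo_kleinSum (R := R) V (Nat.lt_succ_self D)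
  exact (agreeTo_twistSer V h).trans (by rw [hsum]; exact h.symm)

/-- The exponent has real coefficients, so multiplication by it commutes with `serMap δ`. Every
power then reduces to `δ 1`, which is zero. -/
lemma serMap_kleinSer_of_leibniz (δ : R →ₗ[ℝ] R) (hδ : ∀ r s, δ (r * s) = δ r * s + r * δ s) :
    serMap δ (kleinSer V R) = 0 := by
  have h1 : δ 1 = 0 := by simpa using hδ 1 1
  have hp : ∀ i f, serMap δ (long V (pVar d R) i * f) = long V (pVar d R) i * serMap δ f :=
    fun i f => by
      simp only [long, Finset.sum_mul, map_sum, smul_mul_assoc, map_smul, serMap_pVar_mul]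
  have hq : ∀ i f, serMap δ (long V (qVar d R) i * f) = long V (qVar d R) i * serMap δ f :=
    fun i f => by
      simp only [long, Finset.sum_mul, map_sum, smul_mul_assoc, map_smul, serMap_qVar_mul]
  have hX : ∀ f, serMap δ (kleinExp V R * f) = kleinExp V R * serMap δ f := fun f => by
    simp only [kleinExp_eq, neg_mul, sub_mul, mul_assoc, map_neg, map_sub, hp, hq]
  have hpow : ∀ n, serMap δ (kleinExp V R ^ n) = 0 := fun n => by
    induction n with
    | zero => rw [pow_zero, serMap_one, h1, map_zero, map_zero]
    | succ n ih => rw [pow_succ', hX, ih, mul_zero]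
  have hsum : ∀ N, serMap δ (kleinSum V R N) = 0 := fun N => by
    simp only [kleinSum, map_sum, map_smul, hpow, smul_zero, Finset.sum_const_zero]
  refine eq_of_agreeTo fun D => ?_
  refine (agreeTo_serMap δ (agreeTo_kleinSum (R := R) V (Nat.lt_succ_self D))).trans ?_
  rw [hsum]
  exact AgreeTo.refl _ _

/-- The first-order term differentiates the exponent in q. One more contraction with ε leaves -2 V^A
times the longitudinal p, which is the reflection term. -/
lemma kleinSer_starMul_pVar (a : Osc d) : starMul (kleinSer V R) (pVar d R a) =
    starMul (reflect V (pVar d R) a) (kleinSer V R) := by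
  obtain ⟨A, j⟩ := a
  rw [reflect_starMul, starMul_pVar]
  simp only [pVar, C_starMul]
  rw [← pVar]
  change _ = reflect V (fun b => pVar d R b * kleinSer V R) (A, j)
  rw [← reflect_mul, mul_comm, reflect, sub_mul, sub_eq_add_neg]
  congr 1
  simp only [dq_kleinSer, dq_kleinExp]
  have hA := eta_mul_self A
  generalize long V (pVar d R) = P
  have hP : ∑ i, eps i j • ∑ l, eps i l • P l = P j := by
    fin_cases j <;> simp [eps]
  rw [← hP, smul_mul_assoc, Finset.sum_mul, Finset.smul_sum, ← Finset.sum_neg_distrib]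
  refine Finset.sum_congr rfl fun i _ => ?_
  simp only [smul_mul_assoc]
  match_scalars
  linear_combination (-2 * eps i j * V A) * hA

/-- Here `adq` acts on K itself, giving a longitudinal term that must be reflected too. The norm
condition makes the contributions -2, -2 and +4 cancel. -/
lemma reflect_qVar_starMul_kleinSer (hV : ∑ A, eta A * V A * V A = 1) (a : Osc d) :
    starMul (reflect V (qVar d R) a) (kleinSer V R) = starMul (kleinSer V R) (qVar d R a) := by
  obtain ⟨A, i⟩ := a
  rw [reflect_starMul, starMul_of_dp_eq_zero fun b => dp_qVar b _]
  simp only [qVar_starMul]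
  rw [reflect_add, ← reflect_mul]
  have hadq : ∀ A i, adq (A, i) (kleinSer V R) =
      (-2 * V A) • (long V (qVar d R) i * kleinSer V R) := fun A i => by
    have hA := eta_mul_self A
    simp only [adq, dp_kleinSer, dp_kleinExp]
    generalize long V (qVar d R) = Q
    have hQ : ∑ j, eps i j • ∑ l, eps j l • Q l = -Q i := by
      fin_cases i <;> simp [eps]
    rw [show (-2 * V A) • (Q i * kleinSer V R) = (2 * V A) • (-Q i * kleinSer V R) by
      rw [neg_mul (Q i)]; module, ← hQ, Finset.sum_mul, Finset.smul_sum]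
    refine Finset.sum_congr rfl fun j _ => ?_
    simp only [neg_mul, smul_mul_assoc]
    match_scalars
    linear_combination (2 * eps i j * V A) * hA
  have hl : long V (fun b => adq b (kleinSer V R)) i =
      (-2 : ℝ) • (long V (qVar d R) i * kleinSer V R) := by
    simp only [long, hadq, smul_smul]
    rw [← Finset.sum_smul]
    congr 1
    have h := congrArg (fun x => -2 * x) hV
    simp only [Finset.mul_sum, mul_one] at h
    exact Eq.trans (Finset.sum_congr rfl fun A _ => by ring) h
  rw [reflect, reflect, hl, hadq, sub_mul, smul_mul_assoc, mul_comm (kleinSer V R)]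
  module

/-- The Klein operator implements the reflection. -/
theorem kleinSer_starMul (hV : ∑ A, eta A * V A * V A = 1) (f : PowSer d R) :
    starMul (kleinSer V R) f = starMul (twistSer V f) (kleinSer V R) := by
  induction f using star_induction with
  | add f f' hf hf' => rw [star_add, hf, hf', map_add, add_star]
  | const r =>
    rw [twistSer_const, C_starMul, starMul_of_dp_eq_zero fun b => dp_const b r, mul_comm]
  | p a => rw [twistSer_pVar, kleinSer_starMul_pVar]
  | q a => rw [twistSer_qVar, reflect_qVar_starMul_kleinSer V hV]
  | mul f f' hf hf' =>
    rw [← starMul_assoc, hf, starMul_assoc, hf', ← starMul_assoc, twistSer_starMul V hV]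
  | lim f hf =>
    exact FinDet.eq_of_approx (finDet_starMul_right _)
      ((finDet_starMul_left _).comp (finDet_twistSer V)) hf

end Klein

/-! ## Formal consistency in an abstract differential algebra -/

section Abstract

variable {A : Type*} [NonUnitalRing A] [Module ℝ A] [IsScalarTower ℝ A A] [SMulCommClass ℝ A A]

/-- The algebraic properties of the differential `δ`, the reflection `τ`, the fields `W`, `S`, `B`, the
Klein operator `K`, the two-form `z = dz_i dz^i` and the two-form `c = dZ^i_A dZ^A_i` that are
responsible for the consistency of the nonlinear system. -/
structure ConsistencyData (δ τ : A →ₗ[ℝ] A) (W S B K z c : A) : Prop where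
  sq_zero : ∀ a, δ (δ a) = 0
  leibniz_W : ∀ a, δ (W * a) = δ W * a - W * δ a
  leibniz_S : ∀ a, δ (S * a) = δ S * a - S * δ a
  leibniz_B : ∀ a, δ (B * a) = δ B * a + B * δ a
  leibniz_z : ∀ a, δ (z * a) = z * δ a
  map_c : δ c = 0
  map_K : δ K = 0
  τ_mul : ∀ a b, τ (a * b) = τ a * τ b
  τ_comm : ∀ a, δ (τ a) = τ (δ a)
  τ_K : τ K = K
  τ_z : τ z = z
  τ_c : τ c = c
  z_comm : ∀ a, a * z = z * a
  c_comm : ∀ a, a * c = c * a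
  K_W : K * W = τ W * K
  K_B : K * B = τ B * K
  -- Unlike `K_W`, this holds only behind `z`: K reflects the coefficients of S but leaves its
  -- differentials alone.
  z_K_S : ∀ a, z * (a * (K * S)) = z * (a * (τ S * K))

variable {δ τ : A →ₗ[ℝ] A} {W S B K z c : A}

/-- The identities of the nonlinear system in the `x`- and `Z`-sectors. -/
theorem ConsistencyData.identities (h : ConsistencyData δ τ W S B K z c) (σ Λ : ℝ)
    {E1 E2 E3 E4 E5 F : A} (hE1 : E1 = δ W + W * W) (hE2 : E2 = δ B + W * B - B * τ W)
    (hE3 : E3 = δ S + W * S + S * W) (hE4 : E4 = S * B - B * τ S) (hE5 : E5 = S * S - F)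
    (hF : F = (-(1 / 2) : ℝ) • (σ • c + (4 * Λ⁻¹) • (z * (B * K)))) :
    δ E1 = E1 * W - W * E1 ∧
    δ E2 = E1 * B - B * τ E1 - (W * E2 + E2 * τ W) ∧
    δ E3 = (E3 * W - W * E3) + (E1 * S - S * E1) ∧
    δ E4 = E3 * B - B * τ E3 - (W * E4 + E4 * τ W) - (S * E2 + E2 * τ S) ∧
    δ E5 = (E5 * W - W * E5) + (E3 * S - S * E3) + (2 * Λ⁻¹) • (z * (E2 * K)) ∧
    S * E1 - E1 * S = -(δ E3 + (W * E3 - E3 * W)) ∧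
    S * E2 + E2 * τ S = E3 * B - B * τ E3 - (δ E4 + W * E4 + E4 * τ W) ∧
    S * E3 - E3 * S = -(δ E5 + (W * E5 - E5 * W)) + (2 * Λ⁻¹) • (z * (E2 * K)) ∧
    S * E4 + E4 * τ S = E5 * B - B * τ E5 ∧
    S * E5 - E5 * S = (2 * Λ⁻¹) • (z * (E4 * K)) ∧
    S * (S * S) = (S * S) * S ∧
    S * F - F * S = -((2 * Λ⁻¹) • (z * (E4 * K))) := by
  have hz : ∀ x a, x * (z * a) = z * (x * a) := fun x a => by
    rw [← mul_assoc, h.z_comm, mul_assoc]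
  have hd1 : δ E1 = δ W * W - W * δ W := by rw [hE1, map_add, h.sq_zero, h.leibniz_W, zero_add]
  have hd2 : δ E2 = δ W * B - W * δ B - δ B * τ W - B * τ (δ W) := by
    rw [hE2, map_sub, map_add, h.sq_zero, h.leibniz_W, h.leibniz_B, h.τ_comm]; abel
  have hd3 : δ E3 = δ W * S - W * δ S + δ S * W - S * δ W := by
    rw [hE3, map_add, map_add, h.sq_zero, h.leibniz_W, h.leibniz_S]; abel
  have hd4 : δ E4 = δ S * B - S * δ B - δ B * τ S - B * τ (δ S) := by
    rw [hE4, map_sub, h.leibniz_S, h.leibniz_B, h.τ_comm]; abel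
  have hdF : δ F = -((2 * Λ⁻¹) • (z * (δ B * K))) := by
    rw [hF, map_smul, map_add, map_smul, map_smul, h.map_c, h.leibniz_z, h.leibniz_B, h.map_K,
      mul_zero, add_zero]
    module
  have hd5 : δ E5 = δ S * S - S * δ S + (2 * Λ⁻¹) • (z * (δ B * K)) := by
    rw [hE5, map_sub, h.leibniz_S, hdF, sub_neg_eq_add]
  have hτF : τ F = (-(1 / 2) : ℝ) • (σ • c + (4 * Λ⁻¹) • (z * (τ B * K))) := by
    rw [hF, map_smul, map_add, map_smul, map_smul, h.τ_c, h.τ_mul, h.τ_mul, h.τ_z, h.τ_K]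
  have hFW : F * W - W * F = -((2 * Λ⁻¹) • (z * ((B * τ W - W * B) * K))) := by
    rw [hF]
    simp only [add_mul, mul_add, sub_mul, mul_sub, smul_mul_assoc, mul_smul_comm, mul_assoc,
      h.K_W, hz W, h.c_comm W]
    module
  have hSF : S * F - F * S = -((2 * Λ⁻¹) • (z * (E4 * K))) := by
    rw [hF, hE4]
    simp only [add_mul, mul_add, sub_mul, mul_sub, smul_mul_assoc, mul_smul_comm, mul_assoc,
      h.z_K_S, hz S, h.c_comm S]
    module
  -- Moving B through K twists it, and B * τB * K is B times the twist of B * K. This is the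
  -- compatibility of the source with the twisted equation for B.
  have hFB : F * B = B * τ F := by
    rw [hτF, hF]
    simp only [add_mul, mul_add, smul_mul_assoc, mul_smul_comm, mul_assoc, h.K_B, hz B, h.c_comm B]
  have h1 : δ E1 = E1 * W - W * E1 := by
    rw [hd1, hE1]; simp only [add_mul, mul_add, mul_assoc]; abel
  have h2 : δ E2 = E1 * B - B * τ E1 - (W * E2 + E2 * τ W) := by
    rw [hd2, hE1, hE2]
    simp only [map_add, h.τ_mul, add_mul, mul_add, sub_mul, mul_sub, mul_assoc]; abel
  have h3 : δ E3 = (E3 * W - W * E3) + (E1 * S - S * E1) := by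
    rw [hd3, hE1, hE3]; simp only [add_mul, mul_add, mul_assoc]; abel
  have h4 : δ E4 = E3 * B - B * τ E3 - (W * E4 + E4 * τ W) - (S * E2 + E2 * τ S) := by
    rw [hd4, hE2, hE3, hE4]
    simp only [map_add, h.τ_mul, add_mul, mul_add, sub_mul, mul_sub, mul_assoc]; abel
  have h5 : δ E5 = (E5 * W - W * E5) + (E3 * S - S * E3) + (2 * Λ⁻¹) • (z * (E2 * K)) := by
    -- The commutator with F is kept as a block, so that `hFW` can replace it before the words in W,
    -- S and B are expanded.
    have hE5W : E5 * W - W * E5 = S * (S * W) - W * (S * S) - (F * W - W * F) := by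
      rw [hE5]; simp only [sub_mul, mul_sub, mul_assoc]; abel
    rw [hd5, hE5W, hFW, hE2, hE3]
    simp only [add_mul, mul_add, sub_mul, mul_sub, mul_assoc]
    module
  refine ⟨h1, h2, h3, h4, h5, ?_, ?_, ?_, ?_, ?_, (mul_assoc _ _ _).symm, hSF⟩
  -- The commutator of S with E1, E2 or E3 already occurs in the differential of E3, E4 or E5, so
  -- these three identities are rearrangements.
  · rw [h3]; abel
  · rw [h4]; abel
  · rw [h5]; abel
  · have : E5 * B - B * τ E5 = S * (S * B) - B * (τ S * τ S) := by
      rw [hE5, map_sub, h.τ_mul, sub_mul, mul_sub, hFB, mul_assoc]; abel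
    rw [this, hE4]
    simp only [sub_mul, mul_sub, mul_assoc]; abel
  · have : S * E5 - E5 * S = -(S * F - F * S) := by
      rw [hE5, mul_sub, sub_mul, mul_assoc]; abel
    rw [this, hSF, neg_neg]

end Abstract

section FormRing

variable {d : ℕ} {R R' : Type} [CommRing R] [Algebra ℝ R] [CommRing R'] [Algebra ℝ R']

lemma symbol_mul_assoc (f g h : Symbol d R) : f * g * h = f * (g * h) := starMul_assoc f g h

lemma form_mul_assoc (a b c : Form d R) : a * b * c = a * (b * c) := by
  induction a using TensorProduct.induction_on with
  | zero => simp only [zero_mul]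
  | add a a' h h' => simp only [add_mul, h, h']
  | tmul θ f =>
    induction b using TensorProduct.induction_on with
    | zero => simp only [zero_mul, mul_zero]
    | add b b' h h' => simp only [add_mul, mul_add, h, h']
    | tmul η g =>
      induction c using TensorProduct.induction_on with
      | zero => simp only [mul_zero]
      | add c c' h h' => simp only [mul_add, h, h']
      | tmul ζ k =>
        simp only [Algebra.TensorProduct.tmul_mul_tmul, mul_assoc, symbol_mul_assoc]

instance : NonUnitalRing (Form d R) where
  mul_assoc := form_mul_assoc

end FormRing

/-! ## The exterior algebra of the differentials -/

section Grassmann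

variable {d : ℕ} (V : Fin (d + 1) → ℝ)

/-- The vector whose image in the exterior algebra is `dz_i`. -/
def dzVec (i : Fin 2) : Gen d → ℝ := long V (fun a => gen (Sum.inr a)) i

lemma dz_eq_ι (i : Fin 2) : dz V i = ExteriorAlgebra.ι ℝ (dzVec V i) :=
  (long_map V (ExteriorAlgebra.ι ℝ (M := Gen d → ℝ)) _ i).symm

lemma ι_mul_ι_comm (u v : Gen d → ℝ) : ExteriorAlgebra.ι ℝ u * ExteriorAlgebra.ι ℝ v =
    -(ExteriorAlgebra.ι ℝ v * ExteriorAlgebra.ι ℝ u) :=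
  eq_neg_of_add_eq_zero_left (ExteriorAlgebra.ι_add_mul_swap u v)

/-- Passing a one-form through a product of two one-forms changes sign twice. -/
lemma ι_mul_ι_central (u v : Gen d → ℝ) (θ : Grass d) :
    θ * (ExteriorAlgebra.ι ℝ u * ExteriorAlgebra.ι ℝ v) =
      ExteriorAlgebra.ι ℝ u * ExteriorAlgebra.ι ℝ v * θ := by
  induction θ using ExteriorAlgebra.induction with
  | algebraMap r => exact Algebra.commutes r _
  | ι w =>
    rw [← mul_assoc, ι_mul_ι_comm w u, neg_mul, mul_assoc, ι_mul_ι_comm w v, mul_neg, neg_neg,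
      mul_assoc]
  | mul θ η hθ hη => rw [mul_assoc, hη, ← mul_assoc, hθ, mul_assoc]
  | add θ η hθ hη => rw [add_mul, hθ, hη, mul_add]

lemma dzdz_central (θ : Grass d) : θ * dzdz V = dzdz V * θ := by
  simp only [dzdz, Finset.mul_sum, Finset.sum_mul, mul_smul_comm, smul_mul_assoc, dz_eq_ι,
    ι_mul_ι_central]

lemma dZdZ_central (θ : Grass d) : θ * dZdZ d = dZdZ d * θ := by
  simp only [dZdZ, Finset.mul_sum, Finset.sum_mul, mul_smul_comm, smul_mul_assoc, dZ,
    ι_mul_ι_central]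

lemma dzdz_mul_dz (j : Fin 2) : dzdz V * dz V j = 0 := by
  have hsq : ∀ i, dz V i * dz V i = 0 := fun i => by rw [dz_eq_ι, ExteriorAlgebra.ι_sq_zero]
  have h10 : dz V 1 * dz V 0 = -(dz V 0 * dz V 1) := by
    rw [dz_eq_ι, dz_eq_ι, ι_mul_ι_comm]
  have h : dzdz V = (2 : ℝ) • (dz V 0 * dz V 1) := by
    simp only [dzdz, Fin.sum_univ_two, hsq, h10]
    simp [eps, two_smul]
  rw [h, smul_mul_assoc]
  fin_cases j
  · change (2 : ℝ) • (dz V 0 * dz V 1 * dz V 0) = 0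
    rw [mul_assoc, h10, mul_neg, ← mul_assoc, hsq, zero_mul, neg_zero, smul_zero]
  · change (2 : ℝ) • (dz V 0 * dz V 1 * dz V 1) = 0
    rw [mul_assoc, hsq, mul_zero, smul_zero]

lemma reflectGen_inl (μ : Fin d) : reflectGen V (gen (Sum.inl μ)) = gen (Sum.inl μ) := by
  have h : (gen (Sum.inl μ) : Gen d → ℝ) = Pi.basisFun ℝ (Gen d) (Sum.inl μ) := by
    rw [Pi.basisFun_apply]; rfl
  conv_lhs => rw [h]
  rw [reflectGen, Module.Basis.constr_basis]
  rfl

lemma reflectGen_inr (a : Osc d) : reflectGen V (gen (Sum.inr a)) =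
    reflect V (fun a => gen (Sum.inr a)) a := by
  have h : (gen (Sum.inr a) : Gen d → ℝ) = Pi.basisFun ℝ (Gen d) (Sum.inr a) := by
    rw [Pi.basisFun_apply]; rfl
  conv_lhs => rw [h]
  rw [reflectGen, Module.Basis.constr_basis]
  rfl

lemma map_reflectGen_dx (μ : Fin d) : ExteriorAlgebra.map (reflectGen V) (dx μ) = dx μ := by
  rw [dx, ExteriorAlgebra.map_apply_ι, reflectGen_inl]

lemma map_reflectGen_dZ (a : Osc d) :
    ExteriorAlgebra.map (reflectGen V) (dZ a) = reflect V dZ a := by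
  rw [dZ, ExteriorAlgebra.map_apply_ι, reflectGen_inr, reflect_map]
  rfl

lemma map_reflectGen_dz (hV : ∑ A, eta A * V A * V A = 1) (i : Fin 2) :
    ExteriorAlgebra.map (reflectGen V) (dz V i) = -dz V i := by
  rw [dz, ← long_reflect V hV, ← AlgHom.toLinearMap_apply, long_map]
  simp only [AlgHom.toLinearMap_apply, map_reflectGen_dZ]

lemma map_reflectGen_dzdz (hV : ∑ A, eta A * V A * V A = 1) :
    ExteriorAlgebra.map (reflectGen V) (dzdz V) = dzdz V := by
  simp only [dzdz, map_sum, map_smul, map_mul, map_reflectGen_dz V hV, neg_mul_neg]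

/-- Reflection is an isometry. The two cross terms contribute -2 each and the quadratic term +4 by
the norm condition, so all corrections cancel. -/
lemma map_reflectGen_dZdZ (hV : ∑ A, eta A * V A * V A = 1) :
    ExteriorAlgebra.map (reflectGen V) (dZdZ d) = dZdZ d := by
  have hr : ∀ A i, reflect V dZ (A, i) = dZ (A, i) - (2 * V A) • dz V i := fun _ _ => rfl
  have hl : ∀ i j, ∑ A, (eta A * V A) • (dz V j * dZ (A, i)) = dz V j * dz V i := fun i j => by
    simp only [dz, long, Finset.mul_sum, mul_smul_comm]
  have hl' : ∀ i j, ∑ A, (eta A * V A) • (dZ (A, j) * dz V i) = dz V j * dz V i := fun i j => by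
    simp only [dz, long, Finset.sum_mul, smul_mul_assoc]
  have key : ∀ i j, ∑ A, (eta A * eps i j) • (reflect V dZ (A, j) * reflect V dZ (A, i)) =
      ∑ A, (eta A * eps i j) • (dZ (A, j) * dZ (A, i)) := fun i j => by
    have hexp : ∀ A, (eta A * eps i j) • (reflect V dZ (A, j) * reflect V dZ (A, i)) =
        (eta A * eps i j) • (dZ (A, j) * dZ (A, i)) -
        (2 * eps i j) • ((eta A * V A) • (dz V j * dZ (A, i))) -
        (2 * eps i j) • ((eta A * V A) • (dZ (A, j) * dz V i)) +
        (4 * eps i j) • ((eta A * V A * V A) • (dz V j * dz V i)) := fun A => by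
      rw [hr, hr]
      simp only [sub_mul, mul_sub, smul_mul_assoc, mul_smul_comm]
      module
    rw [Finset.sum_congr rfl fun A _ => hexp A]
    rw [Finset.sum_add_distrib, Finset.sum_sub_distrib, Finset.sum_sub_distrib, ← Finset.smul_sum,
      ← Finset.smul_sum, ← Finset.smul_sum, hl, hl', ← Finset.sum_smul, hV]
    module
  have hswap : ∀ F : Fin (d + 1) → Fin 2 → Fin 2 → Grass d,
      ∑ A, ∑ i, ∑ j, F A i j = ∑ i, ∑ j, ∑ A, F A i j := fun F => by
    rw [Finset.sum_comm]
    exact Finset.sum_congr rfl fun i _ => Finset.sum_comm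
  simp only [dZdZ, map_sum, map_smul, map_mul, map_reflectGen_dZ]
  rw [hswap, hswap]
  exact Finset.sum_congr rfl fun i _ => Finset.sum_congr rfl fun j _ => key i j

/-- The reflection changes dZ by a multiple of some dz_j, which the two-form annihilates. This makes
the untwisted differentials in `z_K_S` harmless. -/
lemma dzdz_mul_reflect_dZ (a : Osc d) : dzdz V * reflect V dZ a = dzdz V * dZ a := by
  change dzdz V * (dZ a - (2 * V a.1) • dz V a.2) = _
  rw [mul_sub, mul_smul_comm, dzdz_mul_dz, smul_zero, sub_zero]

end Grassmann

/-! ## Operations on forms -/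

section Forms

variable {d : ℕ} {R R' : Type} [CommRing R] [Algebra ℝ R] [CommRing R'] [Algebra ℝ R']
variable (V : Fin (d + 1) → ℝ)

lemma symMap_mul_of_mul (φ : R →ₗ[ℝ] R') (h1 : φ 1 = 1) (hφ : ∀ r s, φ (r * s) = φ r * φ s)
    (f g : Symbol d R) : symMap φ (f * g) = symMap φ f * symMap φ g :=
  serMap_starMul_of_mul φ h1 hφ f g

lemma symMap_mul_of_leibniz (δ : R →ₗ[ℝ] R) (hδ : ∀ r s, δ (r * s) = δ r * s + r * δ s)
    (f g : Symbol d R) : symMap δ (f * g) = symMap δ f * g + f * symMap δ g :=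
  serMap_starMul_of_leibniz δ hδ f g

lemma twist_mul (hV : ∑ A, eta A * V A * V A = 1) (f g : Symbol d R) :
    twist V (f * g) = twist V f * twist V g :=
  twistSer_starMul V hV f g

lemma symbol_one_mul (f : Symbol d R) : 1 * f = f := one_starMul f

lemma symbol_mul_one (f : Symbol d R) : f * 1 = f := starMul_one f

lemma klein_mul (hV : ∑ A, eta A * V A * V A = 1) (f : Symbol d R) :
    klein V * f = twist V f * klein V :=
  kleinSer_starMul V hV f

lemma twist_klein (hV : ∑ A, eta A * V A * V A = 1) :
    twist V (klein V : Symbol d R) = klein V :=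
  twistSer_kleinSer V hV

lemma twist_one : twist V (1 : Symbol d R) = 1 := twistSer_one V

lemma symMap_klein_of_leibniz (δ : R →ₗ[ℝ] R) (hδ : ∀ r s, δ (r * s) = δ r * s + r * δ s) :
    symMap δ (klein V : Symbol d R) = 0 :=
  serMap_kleinSer_of_leibniz V δ hδ

lemma symMap_one_of_leibniz (δ : R →ₗ[ℝ] R) (hδ : ∀ r s, δ (r * s) = δ r * s + r * δ s) :
    symMap δ (1 : Symbol d R) = 0 := by
  have h1 : δ 1 = 0 := by simpa using hδ 1 1
  refine (serMap_one δ).trans ?_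
  rw [h1, map_zero, map_zero]
  rfl

lemma map_mul_of_tmul {f : Grass d →ₐ[ℝ] Grass d} {T : Symbol d R →ₗ[ℝ] Symbol d R'}
    (hT : ∀ g h, T (g * h) = T g * T h) (a b : Form d R) :
    TensorProduct.map f.toLinearMap T (a * b) =
      TensorProduct.map f.toLinearMap T a * TensorProduct.map f.toLinearMap T b := by
  induction a using TensorProduct.induction_on with
  | zero => simp only [zero_mul, map_zero]
  | add a a' h h' => simp only [add_mul, map_add, h, h']
  | tmul θ g =>
    induction b using TensorProduct.induction_on with
    | zero => simp only [mul_zero, map_zero]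
    | add b b' h h' => simp only [mul_add, map_add, h, h']
    | tmul η h =>
      simp only [Algebra.TensorProduct.tmul_mul_tmul, TensorProduct.map_tmul, hT,
        AlgHom.toLinearMap_apply, map_mul]

lemma tilde_mul (hV : ∑ A, eta A * V A * V A = 1) (a b : Form d R) :
    tilde V (a * b) = tilde V a * tilde V b :=
  map_mul_of_tmul (twist_mul V hV) a b

lemma tilde_tmul (θ : Grass d) (f : Symbol d R) :
    tilde V (θ ⊗ₜ[ℝ] f) = ExteriorAlgebra.map (reflectGen V) θ ⊗ₜ[ℝ] twist V f := rfl

variable (D : Fin d → R →ₗ[ℝ] R)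

lemma extD_tmul (θ : Grass d) (f : Symbol d R) :
    extD D (θ ⊗ₜ[ℝ] f) = ∑ μ, (dx μ * θ) ⊗ₜ[ℝ] symMap (D μ) f := by
  simp only [extD, LinearMap.sum_apply, TensorProduct.map_tmul, LinearMap.mulLeft_apply]

/-- The sign `s` records how dx passes `θ`, so a single computation gives the Leibniz rule for
one-forms (-1) and for zero-forms and central forms (+1). -/
lemma extD_mul_of_comm (hD : ∀ μ r s, D μ (r * s) = D μ r * s + r * D μ s) {s : ℝ} {θ : Grass d}
    (hθ : ∀ μ, dx μ * θ = s • (θ * dx μ)) (f : Symbol d R) (b : Form d R) :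
    extD D (θ ⊗ₜ[ℝ] f * b) = extD D (θ ⊗ₜ[ℝ] f) * b + s • (θ ⊗ₜ[ℝ] f * extD D b) := by
  induction b using TensorProduct.induction_on with
  | zero => simp only [mul_zero, map_zero, smul_zero, add_zero]
  | add b b' h h' => rw [mul_add, map_add, h, h', map_add, mul_add, mul_add, smul_add]; abel
  | tmul η g =>
    simp only [Algebra.TensorProduct.tmul_mul_tmul, extD_tmul, Finset.sum_mul, Finset.mul_sum,
      Finset.smul_sum, ← Finset.sum_add_distrib]
    refine Finset.sum_congr rfl fun μ _ => ?_
    rw [symMap_mul_of_leibniz _ (hD μ), TensorProduct.tmul_add, TensorProduct.smul_tmul',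
      ← mul_assoc (dx μ), ← mul_assoc θ, ← smul_mul_assoc, ← hθ]

lemma extD_xOneForm_mul (hD : ∀ μ r s, D μ (r * s) = D μ r * s + r * D μ s)
    (W : Fin d → Symbol d R) (b : Form d R) :
    extD D (xOneForm W * b) = extD D (xOneForm W) * b - xOneForm W * extD D b := by
  simp only [xOneForm, Finset.sum_mul, map_sum, ← Finset.sum_sub_distrib]
  refine Finset.sum_congr rfl fun ν _ => ?_
  rw [extD_mul_of_comm D hD (s := -1) fun μ => by
    rw [dx, dx, ι_mul_ι_comm, neg_one_smul], neg_one_smul, sub_eq_add_neg]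

lemma extD_zOneForm_mul (hD : ∀ μ r s, D μ (r * s) = D μ r * s + r * D μ s)
    (S : Osc d → Symbol d R) (b : Form d R) :
    extD D (zOneForm S * b) = extD D (zOneForm S) * b - zOneForm S * extD D b := by
  simp only [zOneForm, Finset.sum_mul, map_sum, ← Finset.sum_sub_distrib]
  refine Finset.sum_congr rfl fun a _ => ?_
  rw [extD_mul_of_comm D hD (s := -1) fun μ => by
    rw [dx, dZ, ι_mul_ι_comm, neg_one_smul], neg_one_smul, sub_eq_add_neg]

lemma extD_zeroForm_mul (hD : ∀ μ r s, D μ (r * s) = D μ r * s + r * D μ s)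
    (B : Symbol d R) (b : Form d R) :
    extD D (zeroForm B * b) = extD D (zeroForm B) * b + zeroForm B * extD D b := by
  rw [zeroForm, extD_mul_of_comm D hD (s := 1) fun μ => by rw [mul_one, one_mul, one_smul], one_smul]

lemma extD_constForm (hD : ∀ μ r s, D μ (r * s) = D μ r * s + r * D μ s) (θ : Grass d) :
    extD D (constForm R θ) = 0 := by
  rw [constForm, extD_tmul]
  exact Finset.sum_eq_zero fun μ _ => by
    rw [symMap_one_of_leibniz _ (hD μ), TensorProduct.tmul_zero]

lemma extD_constForm_mul (hD : ∀ μ r s, D μ (r * s) = D μ r * s + r * D μ s) {θ : Grass d}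
    (hθ : ∀ η, η * θ = θ * η) (b : Form d R) :
    extD D (constForm R θ * b) = constForm R θ * extD D b := by
  have h := extD_mul_of_comm D hD (s := 1) (θ := θ) (fun μ => by rw [hθ, one_smul]) 1 b
  rw [constForm, h, ← constForm, extD_constForm D hD, zero_mul, zero_add, one_smul]

lemma extD_zeroForm_klein (hD : ∀ μ r s, D μ (r * s) = D μ r * s + r * D μ s) :
    extD D (zeroForm (klein V)) = 0 := by
  rw [zeroForm, extD_tmul]
  exact Finset.sum_eq_zero fun μ _ => by
    rw [symMap_klein_of_leibniz V _ (hD μ), TensorProduct.tmul_zero]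

lemma extD_tilde (hV : ∑ A, eta A * V A * V A = 1)
    (hD : ∀ μ r s, D μ (r * s) = D μ r * s + r * D μ s) (a : Form d R) :
    extD D (tilde V a) = tilde V (extD D a) := by
  induction a using TensorProduct.induction_on with
  | zero => simp only [map_zero]
  | add a a' h h' => simp only [map_add, h, h']
  | tmul θ f =>
    rw [tilde_tmul, extD_tmul, extD_tmul, map_sum]
    refine Finset.sum_congr rfl fun μ _ => ?_
    rw [tilde_tmul, map_mul, map_reflectGen_dx]
    exact congrArg _ (serMap_twistSer_of_leibniz V hV (D μ) (hD μ) f)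

lemma eq_zero_of_eq_neg {M : Type*} [AddCommGroup M] [Module ℝ M] {x : M} (h : x = -x) : x = 0 := by
  have h2 : (2 : ℝ) • x = 0 := by rw [two_smul]; nth_rw 1 [h]; exact neg_add_cancel x
  exact (smul_eq_zero.1 h2).resolve_left two_ne_zero

lemma extD_extD (hD : ∀ μ ν r, D μ (D ν r) = D ν (D μ r)) (a : Form d R) :
    extD D (extD D a) = 0 := by
  induction a using TensorProduct.induction_on with
  | zero => simp only [map_zero]
  | add a a' h h' => simp only [map_add, h, h', add_zero]
  | tmul θ f =>
    simp only [extD_tmul, map_sum]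
    set T : Fin d → Fin d → Form d R := fun μ ν =>
      (dx ν * (dx μ * θ)) ⊗ₜ[ℝ] symMap (D ν) (symMap (D μ) f) with hT
    -- The differentials dx anticommute while the operators `D μ` commute, so the double sum equals
    -- its own negative.
    have hanti : ∀ μ ν, T μ ν = -T ν μ := fun μ ν => by
      have h1 : symMap (D ν) (symMap (D μ) f) = symMap (D μ) (symMap (D ν) f) :=
        powSer_ext fun m k => hD ν μ _
      simp only [hT]
      rw [h1, ← TensorProduct.neg_tmul, ← mul_assoc, ← mul_assoc, ← neg_mul]
      rw [show dx ν * dx μ = -(dx μ * dx ν : Grass d) from ι_mul_ι_comm _ _]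
    have h : ∑ μ, ∑ ν, T μ ν = -∑ μ, ∑ ν, T μ ν := by
      conv_lhs => rw [Finset.sum_comm]
      simp only [← Finset.sum_neg_distrib]
      exact Finset.sum_congr rfl fun μ _ => Finset.sum_congr rfl fun ν _ => hanti ν μ
    exact eq_zero_of_eq_neg h

lemma constForm_comm {θ : Grass d} (hθ : ∀ η, η * θ = θ * η) (a : Form d R) :
    a * constForm R θ = constForm R θ * a := by
  induction a using TensorProduct.induction_on with
  | zero => rw [zero_mul, mul_zero]
  | add a a' h h' => rw [add_mul, h, h', mul_add]
  | tmul η f =>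
    rw [constForm, Algebra.TensorProduct.tmul_mul_tmul, Algebra.TensorProduct.tmul_mul_tmul,
      symbol_mul_one, symbol_one_mul, hθ]

lemma tilde_constForm {θ : Grass d} (hθ : ExteriorAlgebra.map (reflectGen V) θ = θ) :
    tilde V (constForm R θ) = constForm R θ := by
  rw [constForm, tilde_tmul, hθ, twist_one]

lemma tilde_zeroForm (f : Symbol d R) : tilde V (zeroForm f) = zeroForm (twist V f) := by
  rw [zeroForm, tilde_tmul, map_one]; rfl

lemma klein_mul_zeroForm (hV : ∑ A, eta A * V A * V A = 1) (f : Symbol d R) :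
    zeroForm (klein V) * zeroForm f = tilde V (zeroForm f) * (zeroForm (klein V) : Form d R) := by
  rw [tilde_zeroForm]
  simp only [zeroForm, Algebra.TensorProduct.tmul_mul_tmul, klein_mul V hV]

lemma klein_mul_xOneForm (hV : ∑ A, eta A * V A * V A = 1) (W : Fin d → Symbol d R) :
    zeroForm (klein V) * xOneForm W = tilde V (xOneForm W) * zeroForm (klein V) := by
  simp only [zeroForm, xOneForm, map_sum, tilde_tmul, map_reflectGen_dx, Finset.mul_sum,
    Finset.sum_mul, Algebra.TensorProduct.tmul_mul_tmul, klein_mul V hV, one_mul, mul_one]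

lemma dzdz_mul_klein_mul_zOneForm (hV : ∑ A, eta A * V A * V A = 1) (S : Osc d → Symbol d R) :
    constForm R (dzdz V) * (zeroForm (klein V) * zOneForm S) =
      constForm R (dzdz V) * (tilde V (zOneForm S) * zeroForm (klein V)) := by
  simp only [constForm, zeroForm, zOneForm, map_sum, tilde_tmul, map_reflectGen_dZ, Finset.mul_sum,
    Finset.sum_mul, Algebra.TensorProduct.tmul_mul_tmul, klein_mul V hV, one_mul, mul_one,
    dzdz_mul_reflect_dZ]

end Forms

/-! ## Smooth functions -/

section Smooth

variable {d : ℕ} (U : TopologicalSpace.Opens (Fin d → ℝ))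

lemma contDiffOn_ext0 (f : SmoothFn U) : ContDiffOn ℝ ∞ (ext0 U f) U := f.2

lemma contDiffAt_ext0 (f : SmoothFn U) (x : U) : ContDiffAt ℝ ∞ (ext0 U f) x :=
  (contDiffOn_ext0 U f).contDiffAt (U.isOpen.mem_nhds x.2)

lemma partialD_apply (μ : Fin d) (f : SmoothFn U) (x : U) :
    (partialD U μ f).1 x = fderiv ℝ (ext0 U f) x (Pi.single μ 1) := rfl

lemma partialD_mul (μ : Fin d) (f g : SmoothFn U) :
    partialD U μ (f * g) = partialD U μ f * g + f * partialD U μ g := by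
  refine Subtype.ext (funext fun x => ?_)
  have hd : ∀ k : SmoothFn U, DifferentiableAt ℝ (ext0 U k) x := fun k =>
    (contDiffAt_ext0 U k x).differentiableAt (by simp)
  have h : ext0 U (f * g : SmoothFn U) = ext0 U f * ext0 U g := by
    funext y
    by_cases hy : y ∈ U <;> simp [ext0, hy]
  change fderiv ℝ (ext0 U (f * g : SmoothFn U)) x (Pi.single μ 1) =
    fderiv ℝ (ext0 U f) x (Pi.single μ 1) * g.1 x + f.1 x * fderiv ℝ (ext0 U g) x (Pi.single μ 1)
  rw [h, fderiv_mul (hd f) (hd g)]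
  simp only [add_apply, smul_apply, smul_eq_mul,
    ext0_of_mem U _ x.2]
  ring

lemma partialD_comm (μ ν : Fin d) (f : SmoothFn U) :
    partialD U μ (partialD U ν f) = partialD U ν (partialD U μ f) := by
  refine Subtype.ext (funext fun x => ?_)
  have hd : DifferentiableAt ℝ (fderiv ℝ (ext0 U f)) x :=
    ((contDiffAt_ext0 U f x).fderiv_right (m := 1) (by norm_cast)).differentiableAt (by simp)
  have h : ∀ μ ν, (partialD U μ (partialD U ν f)).1 x =
      fderiv ℝ (fderiv ℝ (ext0 U f)) x (Pi.single μ 1) (Pi.single ν 1) := fun μ ν => by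
    rw [partialD_apply]
    -- Extension by zero is harmless near a point of the open set, so the iterated partial
    -- derivative is a value of the second derivative, which is symmetric.
    have he : ext0 U (partialD U ν f) =ᶠ[nhds (x : Fin d → ℝ)]
        fun y => fderiv ℝ (ext0 U f) y (Pi.single ν 1) := by
      filter_upwards [U.isOpen.mem_nhds x.2] with y hy
      exact ext0_of_mem U _ hy
    rw [he.fderiv_eq, fderiv_clm_apply hd (differentiableAt_const _)]
    simp
  rw [h, h]
  exact ((contDiffAt_ext0 U f x).isSymmSndFDerivAt (by simp; norm_cast)).eq _ _

/-- Neither the star product nor the exterior product differentiates in x, and evaluation of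
coefficients is a ring homomorphism. -/
lemma valueAt_mul (x : U) (a b : Form d (SmoothFn U)) :
    valueAt U x (a * b) = valueAt U x a * valueAt U x b :=
  map_mul_of_tmul (f := AlgHom.id ℝ _)
    (symMap_mul_of_mul (evalPt U x) rfl fun _ _ => rfl) a b

lemma valueAt_tilde (V : Fin (d + 1) → ℝ) (hV : ∑ A, eta A * V A * V A = 1) (x : U)
    (a : Form d (SmoothFn U)) : valueAt U x (tilde V a) = tilde V (valueAt U x a) := by
  induction a using TensorProduct.induction_on with
  | zero => simp only [map_zero]
  | add a a' h h' => simp only [map_add, h, h']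
  | tmul θ f =>
    exact congrArg (fun g => ExteriorAlgebra.map (reflectGen V) θ ⊗ₜ[ℝ] g)
      (serMap_twistSer_of_mul V hV (evalPt U x) rfl (fun _ _ => rfl) f)

end Smooth

/-! ## Consistency of the nonlinear system -/

lemma Fields.consistencyData {d : ℕ} {U : TopologicalSpace.Opens (Fin d → ℝ)}
    {V : Fin (d + 1) → ℝ} (hV : ∑ A, eta A * V A * V A = 1) (Φ : Fields d U) :
    ConsistencyData (deRham U) (tilde V) Φ.W Φ.S Φ.B (K U V) (dz2 U V)
      (constForm (SmoothFn U) (dZdZ d)) where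
  sq_zero := extD_extD _ (partialD_comm U)
  leibniz_W := extD_xOneForm_mul _ (partialD_mul U) _
  leibniz_S := extD_zOneForm_mul _ (partialD_mul U) _
  leibniz_B := extD_zeroForm_mul _ (partialD_mul U) _
  leibniz_z := extD_constForm_mul _ (partialD_mul U) (dzdz_central V)
  map_c := extD_constForm _ (partialD_mul U) _
  map_K := extD_zeroForm_klein V _ (partialD_mul U)
  τ_mul := tilde_mul V hV
  τ_comm := extD_tilde V _ hV (partialD_mul U)
  τ_K := (tilde_zeroForm V _).trans (congrArg zeroForm (twist_klein V hV))
  τ_z := tilde_constForm V (map_reflectGen_dzdz V hV)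
  τ_c := tilde_constForm V (map_reflectGen_dZdZ V hV)
  z_comm := constForm_comm (dzdz_central V)
  c_comm := constForm_comm dZdZ_central
  K_W := klein_mul_xOneForm V hV _
  K_B := klein_mul_zeroForm V hV _
  z_K_S a := by
    have h := dzdz_mul_klein_mul_zOneForm (R := SmoothFn U) V hV Φ.SiA
    have hz : ∀ b, dz2 U V * (a * b) = a * (dz2 U V * b) := fun b => by
      rw [← mul_assoc, ← mul_assoc, dz2, constForm_comm (dzdz_central V)]
    rw [hz, hz]
    exact congrArg (a * ·) h

end

end HigherSpin

open HigherSpin HigherSpin.Fields in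
/-- Formal consistency of the nonlinear system. -/
theorem mainTheorem6 (d : ℕ) (U : TopologicalSpace.Opens (Fin d → ℝ)) (V : Fin (d + 1) → ℝ)
    (hV : ∑ A, eta A * V A * V A = 1) (σ Λ : ℝ) (hΛ : Λ ≠ 0) :
    -- associativity, `d² = 0` and `dz_i dz^i dz_j = 0`
    (∀ a b c : Form d (SmoothFn U), a * b * c = a * (b * c)) ∧
    (∀ a : Form d (SmoothFn U), deRham U (deRham U a) = 0) ∧
    (∀ j : Fin 2, dzdz V * dz V j = 0) ∧
    ∀ Φ : Fields d U,
      -- the differential of each equation, for arbitrary fields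
      deRham U Φ.E1 = Φ.E1 * Φ.W - Φ.W * Φ.E1 ∧
      deRham U (Φ.E2 V) =
        Φ.E1 * Φ.B - Φ.B * tilde V Φ.E1 - (Φ.W * Φ.E2 V + Φ.E2 V * tilde V Φ.W) ∧
      deRham U Φ.E3 = (Φ.E3 * Φ.W - Φ.W * Φ.E3) + (Φ.E1 * Φ.S - Φ.S * Φ.E1) ∧
      deRham U (Φ.E4 V) =
        Φ.E3 * Φ.B - Φ.B * tilde V Φ.E3 - (Φ.W * Φ.E4 V + Φ.E4 V * tilde V Φ.W)
          - (Φ.S * Φ.E2 V + Φ.E2 V * tilde V Φ.S) ∧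
      deRham U (Φ.E5 V σ Λ) =
        (Φ.E5 V σ Λ * Φ.W - Φ.W * Φ.E5 V σ Λ) + (Φ.E3 * Φ.S - Φ.S * Φ.E3)
          + (2 * Λ⁻¹) • (dz2 U V * (Φ.E2 V * K U V)) ∧
      -- the (anti)commutator of `S` with each equation, for arbitrary fields
      Φ.S * Φ.E1 - Φ.E1 * Φ.S = -(deRham U Φ.E3 + (Φ.W * Φ.E3 - Φ.E3 * Φ.W)) ∧
      Φ.S * Φ.E2 V + Φ.E2 V * tilde V Φ.S =
        Φ.E3 * Φ.B - Φ.B * tilde V Φ.E3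
          - (deRham U (Φ.E4 V) + Φ.W * Φ.E4 V + Φ.E4 V * tilde V Φ.W) ∧
      Φ.S * Φ.E3 - Φ.E3 * Φ.S =
        -(deRham U (Φ.E5 V σ Λ) + (Φ.W * Φ.E5 V σ Λ - Φ.E5 V σ Λ * Φ.W))
          + (2 * Λ⁻¹) • (dz2 U V * (Φ.E2 V * K U V)) ∧
      Φ.S * Φ.E4 V + Φ.E4 V * tilde V Φ.S =
        Φ.E5 V σ Λ * Φ.B - Φ.B * tilde V (Φ.E5 V σ Λ) ∧
      Φ.S * Φ.E5 V σ Λ - Φ.E5 V σ Λ * Φ.S = (2 * Λ⁻¹) • (dz2 U V * (Φ.E4 V * K U V)) ∧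
      -- associativity of `S * S * S` against the right-hand side of the equation for `S * S`
      Φ.S * (Φ.S * Φ.S) = (Φ.S * Φ.S) * Φ.S ∧
      Φ.S * Φ.source V σ Λ - Φ.source V σ Λ * Φ.S =
        -((2 * Λ⁻¹) • (dz2 U V * (Φ.E4 V * K U V))) ∧
      -- at any single point where the equations hold, their differentials vanish as well, and the
      -- right-hand side of the equation for `S * S` commutes with `S`
      (∀ x : U, valueAt U x Φ.E1 = 0 → valueAt U x (Φ.E2 V) = 0 → valueAt U x Φ.E3 = 0 →
        valueAt U x (Φ.E4 V) = 0 → valueAt U x (Φ.E5 V σ Λ) = 0 →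
          valueAt U x (deRham U Φ.E1) = 0 ∧ valueAt U x (deRham U (Φ.E2 V)) = 0 ∧
          valueAt U x (deRham U Φ.E3) = 0 ∧ valueAt U x (deRham U (Φ.E4 V)) = 0 ∧
          valueAt U x (deRham U (Φ.E5 V σ Λ)) = 0) ∧
      (∀ x : U, valueAt U x (Φ.E4 V) = 0 →
        valueAt U x (Φ.S * Φ.source V σ Λ) = valueAt U x (Φ.source V σ Λ * Φ.S)) := by
  refine ⟨form_mul_assoc, extD_extD _ (partialD_comm U), dzdz_mul_dz V, fun Φ => ?_⟩
  have h := (Φ.consistencyData hV).identities σ Λ (E1 := Φ.E1) (E2 := Φ.E2 V) (E3 := Φ.E3)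
    (E4 := Φ.E4 V) (E5 := Φ.E5 V σ Λ) (F := Φ.source V σ Λ) rfl rfl rfl rfl rfl rfl
  obtain ⟨d1, d2, d3, d4, d5, s1, s2, s3, s4, s5, hS, hF⟩ := h
  refine ⟨d1, d2, d3, d4, d5, s1, s2, s3, s4, s5, hS, hF, fun x h1 h2 h3 h4 h5 => ?_, fun x h4 => ?_⟩
  -- Vanishing at one point says nothing directly about derivatives there. The identities replace
  -- each differential by an expression in which every term contains an undifferentiated equation as
  -- a factor, possibly twisted, and such an expression may be evaluated at the point.
  · rw [d1, d2, d3, d4, d5]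
    simp only [map_add, map_sub, map_smul, valueAt_mul, valueAt_tilde U V hV, h1, h2, h3, h4, h5,
      map_zero, zero_mul, mul_zero, sub_zero, add_zero, smul_zero, and_self]
  · rw [← sub_eq_zero, ← map_sub, hF]
    simp only [map_neg, map_smul, valueAt_mul, h4, zero_mul, mul_zero, smul_zero, neg_zero]
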